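/- All manifolds (finite-dimensional, without boundary) and maps are smooth; a fibration is a surjective submersion. Let $\pi:P\to M$ be a fibration and $H\subset TP$ a smooth distribution with normal bundle $\mathcal N_H=TP/H$, symbol space $\mathfrak g(H)=H\cap\ker d\pi$, and curvature $\kappa_H:H\times H\to\mathcal N_H$, $\kappa_H(U,V)=[U,V]\bmod H$ on sections. $(P,H)$ is a Pfaffian fibration over $M$ if $TP=H+\ker d\pi$ and $\mathfrak g(H)$ is Frobenius-involutive. A Pfaffian prolongation $\phi:(P',H')\to(P,H)$ between Pfaffian fibrations $\pi':P'\to M$ and $\pi:P\to M$ is a surjective submersion $\phi:P'\to P$ with $\pi\circ\phi=\pi'$ and $$d\phi(H')\subset H,\qquad \mathfrak g(H')\subset\ker d\phi,\qquad \kappa_H(d\phi(u),d\phi(v))=0\ \text{ for all } p'\in P',\ u,v\in H'_{p'}.$$ Let $J^1P$ be the manifold of pairs $(p,\zeta)$ with $p\in P$ and $\zeta:T_{\pi(p)}M\to T_pP$ linear with $d_p\pi\circ\zeta=\mathrm{id}$ (a submanifold of the vector bundle $\mathrm{Hom}(\pi^*TM,TP)$ over $P$), $\mathrm{pr}(p,\zeta)=p$,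 and let $\mathcal C\subset TJ^1P$ be the Cartan distribution, $\mathcal C_{(p,\zeta)}=\{w : d\mathrm{pr}(w)=\zeta(d(\pi\circ\mathrm{pr})(w))\}$. Put $$J^1_HP=\{(p,\zeta)\in J^1P : \mathrm{Im}\,\zeta\subset H_p\},\qquad \mathrm{Prol}(P,H)=\{(p,\zeta)\in J^1_HP : \kappa_H(\zeta(X),\zeta(Y))=0\ \ \forall X,Y\in T_{\pi(p)}M\}.$$ The set $J^1_HP$ is a submanifold of $J^1P$; let $H^{(1)}=\mathcal C\cap TJ^1_HP$. No smoothness of $\mathrm{Prol}(P,H)$ is assumed. **Proposition.** Let $\phi:(P',H')\to(P,H)$ be a Pfaffian prolongation. (1) There is a smooth map $\varphi:P'\to J^1_HP$ with values in $\mathrm{Prol}(P,H)$ such that $\mathrm{pr}\circ\varphi=\phi$ and $d\varphi(H')\subset H^{(1)}$. It is the only smooth map $P'\to J^1_HP$ with these last two properties. It satisfies, on $H'\times H'$, $$[d\mathrm{pr}]\circ\varphi^*\kappa_{H^{(1)}}=[d\phi]\circ\kappa_{H'}=0,$$ where $[d\mathrm{pr}]:\mathcal N_{H^{(1)}}\to\mathrm{pr}^*\mathcal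 N_H$ and $[d\phi]:\mathcal N_{H'}\to\phi^*\mathcal N_H$ are the maps $[u]\mapsto[d\mathrm{pr}(u)]$ and $[u]\mapsto[d\phi(u)]$ induced on the normal bundles. (2) If $\mathrm{Prol}(P,H)$ is an embedded submanifold, there is a unique smooth map $\varphi:P'\to\mathrm{Prol}(P,H)$ with $\mathrm{pr}\circ\varphi=\phi$ and $d\varphi(H')\subset H^{(1)}$, where now $H^{(1)}=\mathcal C\cap T\,\mathrm{Prol}(P,H)$, and $[d\mathrm{pr}]\circ\varphi^*\kappa_{H^{(1)}}=[d\phi]\circ\kappa_{H'}=0$ holds for this $H^{(1)}$. (3) The projection $\mathrm{pr}:\mathrm{Prol}(P,H)\to P$ is surjective. -/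

import Mathlib

open Set Filter Manifold
open scoped Manifold ContDiff Topology

noncomputable section

namespace Pfaffian

/-! ### Distributions on manifolds, involutivity and curvature -/

section Distributions

variable {E : Type*} [NormedAddCommGroup E] [NormedSpace ℝ E]
  {A : Type*} [TopologicalSpace A] (I : ModelWithCorners ℝ E A)
  {X : Type*} [TopologicalSpace X] [ChartedSpace A X]
  {E' : Type*} [NormedAddCommGroup E'] [NormedSpace ℝ E']
  {A' : Type*} [TopologicalSpace A'] (I' : ModelWithCorners ℝ E' A')
  {X' : Type*} [TopologicalSpace X'] [ChartedSpace A' X']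

/-- The (not necessarily continuous) field of subspaces `D x ⊆ T_x X` is a smooth distribution,
i.e. a smooth vector subbundle of `TX`: near every point it is spanned by finitely many pointwise
linearly independent smooth vector fields. -/
def IsSmoothDistribution [IsManifold I ∞ X] (D : ∀ x : X, Submodule ℝ (TangentSpace I x)) : Prop :=
  ∀ x : X, ∃ (k : ℕ) (W : Fin k → ∀ y : X, TangentSpace I y), ∀ᶠ y in 𝓝 x,
    (∀ i, ContMDiffAt I I.tangent ∞ (fun z => (⟨z, W i z⟩ : TangentBundle I X)) y) ∧
    LinearIndependent ℝ (fun i => W i y) ∧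
    D y = Submodule.span ℝ (range fun i => W i y)

/-- `U` is a vector field on `X`, smooth near `x`, whose values at the points of `S` near `x`
lie in `D`. When `S` is an embedded submanifold of `X` and `D y ⊆ T_y S` for `y ∈ S`, these are the
local extensions to `X` of the local sections of the distribution `D` on `S`; when `S = univ`, they
are the local sections of `D` near `x`. -/
def IsLocalSection [IsManifold I ∞ X] (S : Set X) (D : ∀ x : X, Submodule ℝ (TangentSpace I x))
    (x : X) (U : ∀ y : X, TangentSpace I y) : Prop :=
  ∀ᶠ y in 𝓝 x, ContMDiffAt I I.tangent ∞ (fun z => (⟨z, U z⟩ : TangentBundle I X)) y ∧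
    (y ∈ S → U y ∈ D y)

/-- Frobenius involutivity: the bracket of two local sections is again a section. -/
def IsInvolutive [IsManifold I ∞ X] (D : ∀ x : X, Submodule ℝ (TangentSpace I x)) : Prop :=
  ∀ (x : X) (U V : ∀ y : X, TangentSpace I y), IsLocalSection I univ D x U →
    IsLocalSection I univ D x V → VectorField.mlieBracket I U V x ∈ D x

open Classical in
/-- The curvature at `x ∈ S` of a distribution `D` on the submanifold `S ⊆ X`:
`κ_D(u, v) = [U, V]_x mod D_x`, for arbitrary local sections `U`, `V` of `D` (extended
to `X`) with `U_x = u` and `V_x = v`. -/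
def curvatureAlong [IsManifold I ∞ X] (S : Set X) (D : ∀ x : X, Submodule ℝ (TangentSpace I x))
    (x : X) (u v : TangentSpace I x) : TangentSpace I x ⧸ D x :=
  if h : ∃ UV : (∀ y : X, TangentSpace I y) × (∀ y : X, TangentSpace I y),
      IsLocalSection I S D x UV.1 ∧ IsLocalSection I S D x UV.2 ∧ UV.1 x = u ∧ UV.2 x = v
  then (D x).mkQ (VectorField.mlieBracket I h.choose.1 h.choose.2 x)
  else 0

/-- The curvature `κ_D : D × D → TX / D` of a distribution `D` on the manifold `X`. -/
def curvature [IsManifold I ∞ X] (D : ∀ x : X, Submodule ℝ (TangentSpace I x))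
    (x : X) (u v : TangentSpace I x) : TangentSpace I x ⧸ D x :=
  curvatureAlong I univ D x u v

/-- The tangent space at `x` of an embedded submanifold `S ⊆ X`, as a subspace of `T_x X`:
the span of the velocities at `x` of the smooth curves in `S` through `x`. -/
def tangentTo (S : Set X) (x : X) : Submodule ℝ (TangentSpace I x) :=
  Submodule.span ℝ {v | ∃ γ : ℝ → X,
    (∀ᶠ t in 𝓝 (0 : ℝ), ContMDiffAt 𝓘(ℝ, ℝ) I ∞ γ t ∧ γ t ∈ S) ∧
    (⟨γ 0, mfderiv 𝓘(ℝ, ℝ) I γ 0 (1 : ℝ)⟩ : TangentBundle I X) = ⟨x, v⟩}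

variable {I I'} in
/-- The map `[df] : T_x X / D_x → T_{f x} X' / D'_{f x}`, `[u] ↦ [df u]`, induced on normal spaces
by a map `f` with `df(D) ⊆ D'`. -/
def normalMap (f : X → X') (D : ∀ x : X, Submodule ℝ (TangentSpace I x))
    (D' : ∀ x : X', Submodule ℝ (TangentSpace I' x)) (x : X)
    (h : ∀ v ∈ D x, mfderiv I I' f x v ∈ D' (f x)) :
    (TangentSpace I x ⧸ D x) →ₗ[ℝ] (TangentSpace I' (f x) ⧸ D' (f x)) :=
  Submodule.mapQ (D x) (D' (f x)) (mfderiv I I' f x).toLinearMap h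

end Distributions

/-! ### Pfaffian fibrations and prolongations -/

section Fibrations

variable {EM : Type*} [NormedAddCommGroup EM] [NormedSpace ℝ EM]
  {M : Type*} [TopologicalSpace M] [ChartedSpace EM M]
  {EP : Type*} [NormedAddCommGroup EP] [NormedSpace ℝ EP]
  {P : Type*} [TopologicalSpace P] [ChartedSpace EP P]
  {EQ : Type*} [NormedAddCommGroup EQ] [NormedSpace ℝ EQ]
  {Q : Type*} [TopologicalSpace Q] [ChartedSpace EQ Q]

/-- The vertical space `T^π_p P = ker d_pπ`. -/
def vertical (π : P → M) (p : P) : Submodule ℝ (TangentSpace 𝓘(ℝ, EP) p) :=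
  (mfderiv 𝓘(ℝ, EP) 𝓘(ℝ, EM) π p).ker

/-- The symbol space `𝔤(H) = T^π P ∩ H`. -/
def symbolSpace (π : P → M) (H : ∀ p : P, Submodule ℝ (TangentSpace 𝓘(ℝ, EP) p)) (p : P) :
    Submodule ℝ (TangentSpace 𝓘(ℝ, EP) p) :=
  vertical (EM := EM) π p ⊓ H p

/-- A surjective submersion. -/
structure IsFibration (f : P → M) : Prop where
  contMDiff : ContMDiff 𝓘(ℝ, EP) 𝓘(ℝ, EM) ∞ f
  surjective : Function.Surjective f
  submersion : ∀ p, Function.Surjective (mfderiv 𝓘(ℝ, EP) 𝓘(ℝ, EM) f p)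

/-- `(P, H)` is a Pfaffian fibration over `M` with projection `π`. -/
structure IsPfaffianFibration [IsManifold 𝓘(ℝ, EP) ∞ P] (π : P → M)
    (H : ∀ p : P, Submodule ℝ (TangentSpace 𝓘(ℝ, EP) p)) : Prop where
  fibration : IsFibration (EM := EM) (EP := EP) π
  smooth : IsSmoothDistribution 𝓘(ℝ, EP) H
  transversal : ∀ p, H p ⊔ vertical (EM := EM) π p = ⊤
  involutive : IsInvolutive 𝓘(ℝ, EP) (symbolSpace (EM := EM) π H)

/-- A Pfaffian morphism `φ : (Q, K) → (P, H)` over `M`. -/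
structure IsPfaffianMorphism (πQ : Q → M) (K : ∀ q : Q, Submodule ℝ (TangentSpace 𝓘(ℝ, EQ) q))
    (π : P → M) (H : ∀ p : P, Submodule ℝ (TangentSpace 𝓘(ℝ, EP) p)) (φ : Q → P) : Prop where
  fibration : IsFibration (EM := EP) (EP := EQ) φ
  over_base : ∀ q, π (φ q) = πQ q
  map_mem : ∀ q, ∀ v ∈ K q, mfderiv 𝓘(ℝ, EQ) 𝓘(ℝ, EP) φ q v ∈ H (φ q)

/-- A (Pfaffian) prolongation `φ : (Q, K) → (P, H)` over `M`. -/
structure IsProlongation [IsManifold 𝓘(ℝ, EP) ∞ P]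
    (πQ : Q → M) (K : ∀ q : Q, Submodule ℝ (TangentSpace 𝓘(ℝ, EQ) q))
    (π : P → M) (H : ∀ p : P, Submodule ℝ (TangentSpace 𝓘(ℝ, EP) p)) (φ : Q → P) : Prop
    extends IsPfaffianMorphism πQ K π H φ where
  symbol_le : ∀ q, symbolSpace (EM := EM) πQ K q ≤ (mfderiv 𝓘(ℝ, EQ) 𝓘(ℝ, EP) φ q).ker
  curvature_eq_zero : ∀ q, ∀ u ∈ K q, ∀ v ∈ K q,
    curvature 𝓘(ℝ, EP) H (φ q) (mfderiv 𝓘(ℝ, EQ) 𝓘(ℝ, EP) φ q u)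
      (mfderiv 𝓘(ℝ, EQ) 𝓘(ℝ, EP) φ q v) = 0

end Fibrations

/-! ### First jets, the partial and the classical prolongation -/

section Jets

variable {EM : Type*} [NormedAddCommGroup EM] [NormedSpace ℝ EM]
  {M : Type*} [TopologicalSpace M] [ChartedSpace EM M] [IsManifold 𝓘(ℝ, EM) ∞ M]
  {EP : Type*} [NormedAddCommGroup EP] [NormedSpace ℝ EP]
  {P : Type*} [TopologicalSpace P] [ChartedSpace EP P] [IsManifold 𝓘(ℝ, EP) ∞ P]

/-- The fibres of a pullback bundle are additive groups (needed to form `Hom` bundles). -/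
instance pullbackAddCommGroup {B B' : Type*} {f : B' → B} {E : B → Type*}
    [∀ x, AddCommGroup (E x)] (x : B') : AddCommGroup (Bundle.Pullback f E x) :=
  inferInstanceAs (AddCommGroup (E (f x)))

/-- The total space of the smooth vector bundle `Hom(π^*TM, TP)` over `P`. Its points are the pairs
`(p, ζ)` with `p ∈ P` and `ζ : T_{π p} M → T_p P` linear. The jet space and both prolongations are
subsets of this manifold, with the induced smooth structures. -/
abbrev HomBundle (π : C^∞⟮𝓘(ℝ, EP), P; 𝓘(ℝ, EM), M⟯) :=
  Bundle.TotalSpace (EM →L[ℝ] EP) (fun p : P =>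
    Bundle.Pullback π (TangentSpace 𝓘(ℝ, EM) : M → Type _) p →L[ℝ] TangentSpace 𝓘(ℝ, EP) p)

/-- The model with corners (without boundary) of the manifold `Hom(π^*TM, TP)`. -/
abbrev homModel (EM EP : Type*) [NormedAddCommGroup EM] [NormedSpace ℝ EM]
    [NormedAddCommGroup EP] [NormedSpace ℝ EP] :
    ModelWithCorners ℝ (EP × (EM →L[ℝ] EP)) (ModelProd EP (EM →L[ℝ] EP)) :=
  𝓘(ℝ, EP).prod 𝓘(ℝ, EM →L[ℝ] EP)

variable (π : C^∞⟮𝓘(ℝ, EP), P; 𝓘(ℝ, EM), M⟯)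
  (H : ∀ p : P, Submodule ℝ (TangentSpace 𝓘(ℝ, EP) p))

/-- The projection `pr : (p, ζ) ↦ p`. -/
def pr (j : HomBundle π) : P := j.proj

variable {π} in
/-- The linear map `ζ` of a point `(p, ζ)`. -/
def zeta (j : HomBundle π) :
    TangentSpace 𝓘(ℝ, EM) (π (pr π j)) →L[ℝ] TangentSpace 𝓘(ℝ, EP) (pr π j) := j.snd

/-- The first jet space `J¹P`, as the space of linear splittings `ζ` of `d_pπ`. -/
def jetSpace : Set (HomBundle π) :=
  {j | ∀ Y, mfderiv 𝓘(ℝ, EP) 𝓘(ℝ, EM) π (pr π j) (zeta j Y) = Y}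

/-- The partial prolongation `J¹_H P`. -/
def partialProl : Set (HomBundle π) :=
  {j | j ∈ jetSpace π ∧ ∀ Y, zeta j Y ∈ H (pr π j)}

/-- The classical prolongation `Prol(P, H)`. -/
def classicalProl : Set (HomBundle π) :=
  {j | j ∈ partialProl π H ∧ ∀ Y Z, curvature 𝓘(ℝ, EP) H (pr π j) (zeta j Y) (zeta j Z) = 0}

variable {π} in
/-- The Cartan form `θ_can(w) = dpr(w) - ζ(dπ(w))` at `j = (p, ζ)`. -/
def cartanForm (j : HomBundle π) :
    TangentSpace (homModel EM EP) j →L[ℝ] TangentSpace 𝓘(ℝ, EP) (pr π j) :=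
  mfderiv (homModel EM EP) 𝓘(ℝ, EP) (pr π) j
    - (zeta j).comp (mfderiv (homModel EM EP) 𝓘(ℝ, EM) (fun j' => π (pr π j')) j)

/-- The distribution `H⁽¹⁾ = ker θ_can ∩ T(J¹_H P)` on `J¹_H P`. -/
def prolDist (j : HomBundle π) : Submodule ℝ (TangentSpace (homModel EM EP) j) :=
  (cartanForm j).ker ⊓ tangentTo (homModel EM EP) (partialProl π H) j

/-- For a manifold `N` and a map `ι : N → Hom(π^*TM, TP)`, the field of subspaces of `TN` which
`dι` maps to the kernel of `θ_can`. If `ι` is an embedding with image `S`, this is the distribution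
`ker θ_can ∩ TS`, transported to `N`. -/
def cartanPullback {EN : Type*} [NormedAddCommGroup EN] [NormedSpace ℝ EN]
    {N : Type*} [TopologicalSpace N] [ChartedSpace EN N] (ι : N → HomBundle π) (n : N) :
    Submodule ℝ (TangentSpace 𝓘(ℝ, EN) n) :=
  ((cartanForm (ι n)).comp (mfderiv 𝓘(ℝ, EN) (homModel EM EP) ι n)).ker

variable {π H} in
/-- `dpr` maps `ker θ_can` to `H` at the points of `J¹_H P`. -/
theorem mfderiv_pr_mem_of_cartan {j : HomBundle π} (hj : j ∈ partialProl π H)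
    {w : TangentSpace (homModel EM EP) j} (hw : cartanForm j w = 0) :
    mfderiv (homModel EM EP) 𝓘(ℝ, EP) (pr π) j w ∈ H (pr π j) := by
  have h : mfderiv (homModel EM EP) 𝓘(ℝ, EP) (pr π) j w
      = zeta j (mfderiv (homModel EM EP) 𝓘(ℝ, EM) (fun j' => π (pr π j')) j w) :=
    sub_eq_zero.1 hw
  rw [h]
  exact hj.2 _

variable {π H} in
theorem mfderiv_pr_mem {j : HomBundle π} (hj : j ∈ partialProl π H) :
    ∀ w ∈ prolDist π H j, mfderiv (homModel EM EP) 𝓘(ℝ, EP) (pr π) j w ∈ H (pr π j) :=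
  fun _ hw => mfderiv_pr_mem_of_cartan hj hw.1

variable {π H} in
theorem mfderiv_pr_comp_mem {EN : Type*} [NormedAddCommGroup EN] [NormedSpace ℝ EN]
    {N : Type*} [TopologicalSpace N] [ChartedSpace EN N] {ι : N → HomBundle π} {n : N}
    (hι : MDifferentiableAt 𝓘(ℝ, EN) (homModel EM EP) ι n) (hn : ι n ∈ partialProl π H) :
    ∀ w ∈ cartanPullback π ι n,
      mfderiv 𝓘(ℝ, EN) 𝓘(ℝ, EP) (fun n' => pr π (ι n')) n w ∈ H (pr π (ι n)) := by
  intro w hw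
  have hpr : MDifferentiableAt (homModel EM EP) 𝓘(ℝ, EP) (pr π) (ι n) :=
    (Bundle.contMDiff_proj (n := ∞) (fun p : P =>
      Bundle.Pullback π (TangentSpace 𝓘(ℝ, EM) : M → Type _) p →L[ℝ]
        TangentSpace 𝓘(ℝ, EP) p)).mdifferentiable (by simp) (ι n)
  have h : mfderiv 𝓘(ℝ, EN) 𝓘(ℝ, EP) (fun n' => pr π (ι n')) n
      = (mfderiv (homModel EM EP) 𝓘(ℝ, EP) (pr π) (ι n)).comp
        (mfderiv 𝓘(ℝ, EN) (homModel EM EP) ι n) := mfderiv_comp n hpr hι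
  rw [h]
  exact mfderiv_pr_mem_of_cartan hn hw

end Jets

end Pfaffian

/-!
A prolongation `φ : (Q, K) → (P, H)` determines, at every `q`, a linear map `ζ` from the tangent
space of `M` to `T_{φ q} P` by `ζ ∘ dπ_Q = dφ` on `K q`. It is well defined: `dπ_Q` is onto on `K q`
by transversality, and `dφ` vanishes on `K q ∩ ker dπ_Q`. Then `Φ q = (φ q, ζ)` lies in `Prol(P, H)`
because `dφ(K) ⊆ H` and `κ_H(dφ, dφ) = 0` (`exists_lift`), and `pr` is onto `P` because `φ` is. The
defining relation of `ζ` says exactly that `dΦ(K)` lies in the kernel of the Cartan form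
(`cartanForm_mfderiv_eq_zero_iff`), which gives uniqueness as well (`lift_unique`). Smoothness of
`Φ` is a matrix computation in a local frame of `K` (`contMDiffAt_lift`); for an embedded
`Prol(P, H)` it descends along the immersion.

All the curvature identities are instances of one fact (`normalMap_curvatureAlong_eq_zero`): if `df`
maps a distribution `D`, defined along a subset `S` of `X` and tangent to `S`, into `H`, then
`df([U, V])` modulo `H` depends only on the values `df(U)`, `df(V)` at the point, and so is zero
whenever `κ_H` vanishes on them. To see this, write `H` locally as the kernel of a smooth
vector-valued 1-form `θ` (`IsSmoothDistribution.exists_form`). The functions `f^*θ(U)` and `f^*θ(V)`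
vanish on `S`, so their derivatives in directions tangent to `S` vanish, and Cartan's formula leaves
`f^*θ([U, V]) = -dθ(df(U), df(V))` (`form_mlieBracket`). This needs no manifold structure on `S`,
which is why the ambient `Hom` bundle is enough to handle `J¹_H P`. Cartan's formula in turn comes
from `[U, V](G) = U(V(G)) - V(U(G))` for vector-valued functions `G` (`dirDeriv_mlieBracket`).
-/

namespace Pfaffian

/-! ### The Lie bracket as a commutator of derivations -/

section Derivations

variable {E : Type*} [NormedAddCommGroup E] [NormedSpace ℝ E]
  {A : Type*} [TopologicalSpace A] {I : ModelWithCorners ℝ E A}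
  {X : Type*} [TopologicalSpace X] [ChartedSpace A X]
  {F : Type*} [NormedAddCommGroup F] [NormedSpace ℝ F]

variable (I) in
/-- The differential of a vector-valued function as a linear map `T_x X → F`: this is `mfderiv`,
with the tangent spaces of the vector space `F` identified with `F`. -/
def differential (G : X → F) (x : X) : TangentSpace I x →L[ℝ] F :=
  mfderiv I 𝓘(ℝ, F) G x

variable (I) in
/-- The derivative `V(G)` of a vector-valued function `G` along a vector field `V`. -/
def dirDeriv (G : X → F) (V : ∀ y : X, TangentSpace I y) (y : X) : F :=
  differential I G y (V y)

theorem contMDiffAt_dirDeriv [IsManifold I ∞ X] {G : X → F} {V : ∀ y : X, TangentSpace I y} {x : X}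
    (hG : ContMDiffAt I 𝓘(ℝ, F) ∞ G x)
    (hV : ContMDiffAt I I.tangent ∞ (fun y => (⟨y, V y⟩ : TangentBundle I X)) x) :
    ContMDiffAt I 𝓘(ℝ, F) ∞ (dirDeriv I G V) x := by
  have h := ContMDiffAt.mfderiv_const (m := ∞) hG (by simp)
  have hV' := (Bundle.contMDiffAt_totalSpace (F := E) (E := (TangentSpace I : X → Type _))).1 hV
  have := h.clm_apply hV'.2
  refine this.congr_of_eventuallyEq ?_
  have hx : ∀ᶠ y in 𝓝 x, y ∈ (trivializationAt E (TangentSpace I) x).baseSet :=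
    (trivializationAt E (TangentSpace I) x).open_baseSet.mem_nhds
      (FiberBundle.mem_baseSet_trivializationAt' x)
  filter_upwards [hx] with y hy
  have hVy : (trivializationAt E (TangentSpace I) x).symmL ℝ y
      ((trivializationAt E (TangentSpace I) x ⟨y, V y⟩).2) = V y := by
    have := (trivializationAt E (TangentSpace I) x).symmL_continuousLinearMapAt (R := ℝ) hy (V y)
    rwa [Bundle.Trivialization.continuousLinearMapAt_apply_of_mem ℝ _ hy] at this
  simp only [inTangentCoordinates, ContinuousLinearMap.inCoordinates,
    ContinuousLinearMap.comp_apply, dirDeriv, differential, id]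
  rw [hVy]
  simp
  rfl

/-- In a vector space, `G'([U, V]) = U(G'(V)) - V(G'(U))`, by symmetry of the second derivative. -/
theorem fderiv_lieBracket {G : E → F} {U V : E → E} {x : E} (hG : ContDiffAt ℝ 2 G x)
    (hU : DifferentiableAt ℝ U x) (hV : DifferentiableAt ℝ V x) :
    fderiv ℝ G x (VectorField.lieBracket ℝ U V x)
      = fderiv ℝ (fun y => fderiv ℝ G y (V y)) x (U x)
        - fderiv ℝ (fun y => fderiv ℝ G y (U y)) x (V x) := by
  have hG' : DifferentiableAt ℝ (fderiv ℝ G) x :=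
    (hG.fderiv_right (m := 1) (by norm_num)).differentiableAt (by simp)
  have hs : IsSymmSndFDerivAt ℝ G x := hG.isSymmSndFDerivAt (by simp)
  rw [fderiv_clm_apply hG' hV, fderiv_clm_apply hG' hU]
  simp only [VectorField.lieBracket, map_sub, add_apply, ContinuousLinearMap.comp_apply,
    ContinuousLinearMap.flip_apply]
  rw [hs.eq (U x) (V x)]
  abel

variable (I) in
/-- The vector field `e_* V` on the model space which represents `V` in the preferred chart `e`
at `x`. -/
def chartField (x : X) (V : ∀ y : X, TangentSpace I y) (z : E) : E :=
  (mfderiv 𝓘(ℝ, E) I (extChartAt I x).symm z).inverse (V ((extChartAt I x).symm z))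

theorem mfderiv_extChartAt_symm_chartField [CompleteSpace E] [I.Boundaryless] [IsManifold I ∞ X]
    {V : ∀ y : X, TangentSpace I y} {x : X} {z : E} (hz : z ∈ (extChartAt I x).target) :
    mfderiv 𝓘(ℝ, E) I (extChartAt I x).symm z (chartField I x V z : E)
      = V ((extChartAt I x).symm z) := by
  have hinv : (mfderiv 𝓘(ℝ, E) I (extChartAt I x).symm z).IsInvertible := by
    have := isInvertible_mfderivWithin_extChartAt_symm hz
    rwa [I.range_eq_univ, mfderivWithin_univ] at this
  exact hinv.self_apply_inverse _

/-- Read in the chart `e` at `x`, the derivative `V(G)` is `(e_* V)(G ∘ e⁻¹)`. -/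
theorem fderiv_comp_extChartAt_symm [CompleteSpace E] [I.Boundaryless] [IsManifold I ∞ X]
    {G : X → F} {V : ∀ y : X, TangentSpace I y} {x : X} {z : E} (hz : z ∈ (extChartAt I x).target)
    (hG : MDifferentiableAt I 𝓘(ℝ, F) G ((extChartAt I x).symm z)) :
    fderiv ℝ (G ∘ (extChartAt I x).symm) z (chartField I x V z)
      = dirDeriv I G V ((extChartAt I x).symm z) := by
  have hs : MDifferentiableAt 𝓘(ℝ, E) I (extChartAt I x).symm z := by
    have := mdifferentiableWithinAt_extChartAt_symm hz
    rwa [I.range_eq_univ, mdifferentiableWithinAt_univ] at this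
  have h := congrArg (fun L => L (chartField I x V z : E)) (mfderiv_comp z hG hs)
  rw [mfderiv_eq_fderiv] at h
  exact h.trans (congrArg (mfderiv I 𝓘(ℝ, F) G ((extChartAt I x).symm z))
    (mfderiv_extChartAt_symm_chartField hz))

theorem differentiableAt_chartField [CompleteSpace E] [I.Boundaryless] [IsManifold I ∞ X]
    {V : ∀ y : X, TangentSpace I y} {x : X}
    (hV : ContMDiffAt I I.tangent ∞ (fun y => (⟨y, V y⟩ : TangentBundle I X)) x) :
    DifferentiableAt ℝ (chartField I x V) (extChartAt I x x) := by
  have hV' := (hV.mdifferentiableAt (by simp)).mdifferentiableWithinAt (s := univ)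
  have := hV'.differentiableWithinAt_mpullbackWithin_vectorField
  rw [I.range_eq_univ, preimage_univ, univ_inter, VectorField.mpullbackWithin_univ] at this
  exact differentiableWithinAt_univ.1 this

theorem chartField_extChartAt_self [CompleteSpace E] [I.Boundaryless] [IsManifold I ∞ X]
    {V : ∀ y : X, TangentSpace I y} {x : X} :
    chartField I x V (extChartAt I x x) = dirDeriv I (extChartAt I x) V x := by
  have h : ∀ z ∈ (extChartAt I x).target,
      chartField I x V z = dirDeriv I (extChartAt I x) V ((extChartAt I x).symm z) := by
    intro z hz
    have h1 := mfderivWithin_extChartAt_symm_comp_mfderiv_extChartAt hz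
    have h2 := mfderiv_extChartAt_comp_mfderivWithin_extChartAt_symm hz
    rw [I.range_eq_univ, mfderivWithin_univ] at h1 h2
    simp only [chartField, dirDeriv, differential]
    rw [ContinuousLinearMap.inverse_eq h1 h2]
    rfl
  rw [h _ (mem_extChartAt_target x), extChartAt_to_inv]

theorem chartField_mlieBracket [CompleteSpace E] [I.Boundaryless] [IsManifold I ∞ X]
    {U V : ∀ y : X, TangentSpace I y} {x : X} :
    chartField I x (VectorField.mlieBracket I U V) (extChartAt I x x)
      = VectorField.lieBracket ℝ (chartField I x U) (chartField I x V) (extChartAt I x x) := by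
  have h : VectorField.mlieBracket I U V x = (mfderiv I 𝓘(ℝ, E) (extChartAt I x) x).inverse
      (VectorField.lieBracket ℝ (chartField I x U) (chartField I x V) (extChartAt I x x) : E) := by
    rw [← VectorField.mlieBracketWithin_univ, VectorField.mlieBracketWithin_apply, I.range_eq_univ,
      preimage_univ, univ_inter, VectorField.mpullbackWithin_univ,
      VectorField.mpullbackWithin_univ]
    exact congrArg _ (congrFun VectorField.lieBracketWithin_univ _)
  rw [chartField_extChartAt_self, dirDeriv, differential, h]
  exact (isInvertible_mfderiv_extChartAt (mem_extChartAt_source x)).self_apply_inverse _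

/-- `[U, V](G) = U(V(G)) - V(U(G))`. -/
theorem dirDeriv_mlieBracket [CompleteSpace E] [I.Boundaryless] [IsManifold I ∞ X]
    {G : X → F} {U V : ∀ y : X, TangentSpace I y} {x : X}
    (hG : ContMDiffAt I 𝓘(ℝ, F) ∞ G x)
    (hU : ContMDiffAt I I.tangent ∞ (fun y => (⟨y, U y⟩ : TangentBundle I X)) x)
    (hV : ContMDiffAt I I.tangent ∞ (fun y => (⟨y, V y⟩ : TangentBundle I X)) x) :
    dirDeriv I G (VectorField.mlieBracket I U V) x
      = dirDeriv I (dirDeriv I G V) U x - dirDeriv I (dirDeriv I G U) V x := by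
  have hz : extChartAt I x x ∈ (extChartAt I x).target := mem_extChartAt_target x
  have hex : (extChartAt I x).symm (extChartAt I x x) = x := extChartAt_to_inv x
  have hsymm : ContMDiffAt 𝓘(ℝ, E) I ∞ (extChartAt I x).symm (extChartAt I x x) := by
    have := contMDiffWithinAt_extChartAt_symm_range_self (I := I) (n := ∞) x
    rwa [I.range_eq_univ, contMDiffWithinAt_univ] at this
  have hGe : ContDiffAt ℝ ∞ (G ∘ (extChartAt I x).symm) (extChartAt I x x) := by
    rw [← contMDiffAt_iff_contDiffAt]
    exact ContMDiffAt.comp _ (by rwa [hex]) hsymm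
  have hGev : ∀ᶠ z in 𝓝 (extChartAt I x x),
      MDifferentiableAt I 𝓘(ℝ, F) G ((extChartAt I x).symm z) := by
    have h1 : ∀ᶠ y in 𝓝 x, MDifferentiableAt I 𝓘(ℝ, F) G y := by
      have := (contMDiffAt_iff_contMDiffAt_nhds (n := 1) (by simp)).1 (hG.of_le (by simp))
      exact this.mono fun y hy => hy.mdifferentiableAt (by simp)
    have h2 : Tendsto (extChartAt I x).symm (𝓝 (extChartAt I x x)) (𝓝 x) := by
      have := hsymm.continuousAt
      rwa [ContinuousAt, hex] at this
    exact h2.eventually h1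
  -- in the chart, `W(G)` is the derivative of `G ∘ e⁻¹` along `e_* W`, at all points near `e x`
  have hev : ∀ W : ∀ y : X, TangentSpace I y,
      (dirDeriv I G W ∘ (extChartAt I x).symm) =ᶠ[𝓝 (extChartAt I x x)] fun z =>
        fderiv ℝ (G ∘ (extChartAt I x).symm) z (chartField I x W z) := by
    intro W
    filter_upwards [extChartAt_target_mem_nhds x, hGev] with z hz1 hz2
    exact (fderiv_comp_extChartAt_symm hz1 hz2).symm
  have hat : ∀ {G' : X → F} (W : ∀ y : X, TangentSpace I y), ContMDiffAt I 𝓘(ℝ, F) ∞ G' x →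
      dirDeriv I G' W x = fderiv ℝ (G' ∘ (extChartAt I x).symm) (extChartAt I x x)
        (chartField I x W (extChartAt I x x)) := by
    intro G' W hG'
    rw [fderiv_comp_extChartAt_symm hz (by rw [hex]; exact hG'.mdifferentiableAt (by simp)), hex]
  rw [hat _ hG, hat U (contMDiffAt_dirDeriv hG hV), hat V (contMDiffAt_dirDeriv hG hU),
    (hev V).fderiv_eq, (hev U).fderiv_eq, chartField_mlieBracket,
    fderiv_lieBracket (hGe.of_le (by norm_cast))
      (differentiableAt_chartField hU) (differentiableAt_chartField hV)]

end Derivations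

/-! ### Local equations of a distribution -/

section LocalEquations

variable {E : Type*} [NormedAddCommGroup E] [NormedSpace ℝ E]
  {A : Type*} [TopologicalSpace A] {I : ModelWithCorners ℝ E A}
  {X : Type*} [TopologicalSpace X] [ChartedSpace A X]
  {EY : Type*} [NormedAddCommGroup EY] [NormedSpace ℝ EY]
  {Y : Type*} [TopologicalSpace Y] [ChartedSpace EY Y]
  {F : Type*} [NormedAddCommGroup F] [NormedSpace ℝ F]

/-- The linear map `ℝᵏ → F` with columns `w i`. -/
def columns {k : ℕ} (w : Fin k → F) : (Fin k → ℝ) →L[ℝ] F :=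
  ∑ i, (ContinuousLinearMap.proj (R := ℝ) (φ := fun _ : Fin k => ℝ) i).smulRight (w i)

theorem columns_apply {k : ℕ} (w : Fin k → F) (c : Fin k → ℝ) :
    columns w c = ∑ i, c i • w i := by
  simp [columns]

theorem contMDiffAt_columns {k : ℕ} {w : Fin k → X → F} {x : X}
    (hw : ∀ i, ContMDiffAt I 𝓘(ℝ, F) ∞ (w i) x) :
    ContMDiffAt I 𝓘(ℝ, (Fin k → ℝ) →L[ℝ] F) ∞ (fun y => columns fun i => w i y) x := by
  unfold columns
  refine contMDiffAt_finsetSum fun i _ => ?_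
  exact ((ContinuousLinearMap.smulRightL ℝ (Fin k → ℝ) F
    (ContinuousLinearMap.proj (R := ℝ) (φ := fun _ : Fin k => ℝ) i)).contDiff.contDiffAt
    ).contMDiffAt.comp x (hw i)

/-- If `L` is a left inverse of `B(x)`, the range of `B(y)` is, for `y` near `x`, the kernel of the
projection `1 - B (L B)⁻¹ L`, which depends smoothly on `y`. -/
theorem exists_smooth_projection {k : ℕ} {B : X → (Fin k → ℝ) →L[ℝ] F} {x : X}
    (hB : ContMDiffAt I 𝓘(ℝ, (Fin k → ℝ) →L[ℝ] F) ∞ B x) (L : F →L[ℝ] (Fin k → ℝ))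
    (hL : (L.comp (B x)) = ContinuousLinearMap.id ℝ _) :
    ∃ Θ : X → (F →L[ℝ] F), ContMDiffAt I 𝓘(ℝ, F →L[ℝ] F) ∞ Θ x ∧
      ∀ᶠ y in 𝓝 x, ∀ v, Θ y v = 0 ↔ ∃ c, B y c = v := by
  have hLB : ContMDiffAt I 𝓘(ℝ, (Fin k → ℝ) →L[ℝ] (Fin k → ℝ)) ∞ (fun y => L.comp (B y)) x :=
    contMDiffAt_const.clm_comp hB
  have hunit : (L.comp (B x)).IsInvertible := by
    rw [hL]; exact ContinuousLinearMap.isInvertible_equiv (f := ContinuousLinearEquiv.refl ℝ _)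
  have hinv : ContMDiffAt I 𝓘(ℝ, (Fin k → ℝ) →L[ℝ] (Fin k → ℝ)) ∞
      (fun y => (L.comp (B y)).inverse) x :=
    ContMDiffAt.comp x (g := ContinuousLinearMap.inverse)
      hunit.contDiffAt_map_inverse.contMDiffAt hLB
  have hev : ∀ᶠ y in 𝓝 x, (L.comp (B y)).IsInvertible := by
    obtain ⟨e, he⟩ := hunit
    have h1 := e.nhds
    rw [he] at h1
    exact hLB.continuousAt.eventually h1
  refine ⟨fun y => ContinuousLinearMap.id ℝ F - (B y).comp ((L.comp (B y)).inverse.comp L),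
    contMDiffAt_const.sub (hB.clm_comp (hinv.clm_comp contMDiffAt_const)), ?_⟩
  filter_upwards [hev] with y hy v
  constructor
  · intro h
    exact ⟨(L.comp (B y)).inverse (L v), (sub_eq_zero.1 h).symm⟩
  · rintro ⟨c, rfl⟩
    have := hy.inverse_apply_self c
    simp only [ContinuousLinearMap.comp_apply] at this
    simp [this]

/-- A smooth distribution is, near every point, the kernel of a smooth vector-valued 1-form,
written `Θ(y) ∘ de(y)` in terms of the preferred chart `e`. -/
theorem IsSmoothDistribution.exists_form [FiniteDimensional ℝ E] [I.Boundaryless]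
    [IsManifold I ∞ X] {D : ∀ x : X, Submodule ℝ (TangentSpace I x)}
    (hD : IsSmoothDistribution I D) (x : X) :
    ∃ Θ : X → (E →L[ℝ] E), ContMDiffAt I 𝓘(ℝ, E →L[ℝ] E) ∞ Θ x ∧
      ∀ᶠ y in 𝓝 x, ∀ v : TangentSpace I y,
        v ∈ D y ↔ Θ y (differential I (extChartAt I x) y v) = 0 := by
  obtain ⟨k, W, hW⟩ := hD x
  have hW' := hW.self_of_nhds
  set e := extChartAt I x
  have heC : ContMDiffAt I 𝓘(ℝ, E) ∞ e x := contMDiffAt_extChartAt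
  have hB : ContMDiffAt I 𝓘(ℝ, (Fin k → ℝ) →L[ℝ] E) ∞
      (fun y => columns fun i => dirDeriv I e (W i) y) x :=
    contMDiffAt_columns fun i => contMDiffAt_dirDeriv heC (hW'.1 i)
  have hcol : ∀ y c, columns (fun i => dirDeriv I e (W i) y) c
      = differential I e y (∑ i, c i • W i y) := by
    intro y c
    rw [columns_apply, map_sum]
    exact Finset.sum_congr rfl fun i _ => (map_smul _ _ _).symm
  have hinj : ∀ y ∈ e.source, Function.Injective (differential I e y) := by
    intro y hy
    have := (isInvertible_mfderiv_extChartAt hy)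
    exact Function.LeftInverse.injective this.inverse_apply_self
  have hker : LinearMap.ker ((columns fun i => dirDeriv I e (W i) x).toLinearMap) = ⊥ := by
    rw [LinearMap.ker_eq_bot']
    intro c hc
    have h0 : differential I e x (∑ i, c i • W i x) = differential I e x 0 := by
      rw [map_zero]; exact (hcol x c).symm.trans hc
    have := hinj x (mem_extChartAt_source x) h0
    exact funext (Fintype.linearIndependent_iff.1 hW'.2.1 c this)
  obtain ⟨L, hL⟩ := LinearMap.exists_leftInverse_of_injective _ hker
  obtain ⟨Θ, hΘ, hΘ'⟩ := exists_smooth_projection hB (LinearMap.toContinuousLinearMap L)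
    (by ext1 c; exact LinearMap.congr_fun hL c)
  refine ⟨Θ, hΘ, ?_⟩
  filter_upwards [hΘ', hW, extChartAt_source_mem_nhds (I := I) x] with y hy hWy hys v
  refine Iff.trans ?_ (hy _).symm
  rw [hWy.2.2, Submodule.mem_span_range_iff_exists_fun]
  refine exists_congr fun c => ?_
  rw [hcol]
  exact ⟨fun h => by rw [h], fun h => hinj y hys h⟩

/-! ### Tangent vectors of subsets -/

/-- A function that vanishes on `S` has zero derivative along the vectors tangent to `S`; this is
where it matters that these are spanned by velocities of curves in `S`. -/
theorem mfderiv_eq_zero_of_mem_tangentTo {S : Set X} {x : X} {g : X → F}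
    (hg : MDifferentiableAt I 𝓘(ℝ, F) g x) (h0 : ∀ᶠ y in 𝓝 x, y ∈ S → g y = 0)
    {v : TangentSpace I x} (hv : v ∈ tangentTo I S x) : differential I g x v = 0 := by
  suffices h : tangentTo I S x ≤ LinearMap.ker (differential I g x).toLinearMap from h hv
  refine Submodule.span_le.2 ?_
  rintro v ⟨γ, hγ, hv⟩
  obtain ⟨rfl, hv⟩ := Bundle.TotalSpace.mk.inj hv
  obtain rfl := eq_of_heq hv
  have hγ0 := hγ.self_of_nhds
  have hγd := hγ0.1.mdifferentiableAt (by simp)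
  have hz : (g ∘ γ) =ᶠ[𝓝 0] fun _ => 0 := by
    filter_upwards [hγ, hγ0.1.continuousAt.eventually h0] with t ht h0t using h0t ht.2
  have hc := mfderiv_comp (0 : ℝ) hg hγd
  have hc' := hz.mfderiv_eq (I := 𝓘(ℝ, ℝ)) (I' := 𝓘(ℝ, F))
  rw [hc, mfderiv_const] at hc'
  exact congrArg (fun L => L (1 : ℝ)) hc'

/-- Every tangent vector is the velocity of a smooth curve, namely of a line in a chart. -/
theorem exists_curve [I.Boundaryless] [IsManifold I ∞ X] (x : X) (v : TangentSpace I x) :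
    ∃ γ : ℝ → X, (∀ᶠ t in 𝓝 (0 : ℝ), ContMDiffAt 𝓘(ℝ, ℝ) I ∞ γ t) ∧ γ 0 = x ∧
      (⟨γ 0, mfderiv 𝓘(ℝ, ℝ) I γ 0 (1 : ℝ)⟩ : TangentBundle I X) = ⟨x, v⟩ := by
  set w : E := differential I (extChartAt I x) x v
  set l : ℝ → E := fun t => extChartAt I x x + t • w with hl
  have hl0 : l 0 = extChartAt I x x := by simp [hl]
  have hlC : ContDiff ℝ ∞ l := by fun_prop
  have hsymm : ∀ z ∈ (extChartAt I x).target, ContMDiffAt 𝓘(ℝ, E) I ∞ (extChartAt I x).symm z := by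
    intro z hz
    exact (contMDiffOn_extChartAt_symm x).contMDiffAt ((isOpen_extChartAt_target x).mem_nhds hz)
  have hsd : MDifferentiableAt 𝓘(ℝ, E) I (extChartAt I x).symm (extChartAt I x x) :=
    (hsymm _ (mem_extChartAt_target x)).mdifferentiableAt (by simp)
  have hγ0 : (extChartAt I x).symm (l 0) = x := by rw [hl0]; exact extChartAt_to_inv x
  refine ⟨fun t => (extChartAt I x).symm (l t), ?_, hγ0, ?_⟩
  · have : ∀ᶠ t in 𝓝 (0 : ℝ), l t ∈ (extChartAt I x).target := by
      refine hlC.continuous.continuousAt.eventually ?_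
      rw [hl0]
      exact extChartAt_target_mem_nhds x
    filter_upwards [this] with t ht
    exact (hsymm _ ht).comp t hlC.contMDiff.contMDiffAt
  · have hlv : mfderiv 𝓘(ℝ, ℝ) 𝓘(ℝ, E) l 0 (1 : ℝ) = w := by
      have : HasDerivAt l w 0 := by
        have := ((hasDerivAt_id (0 : ℝ)).smul_const w).const_add (extChartAt I x x)
        rwa [one_smul] at this
      rw [mfderiv_eq_fderiv]
      exact this.deriv
    have h1 : mfderiv 𝓘(ℝ, ℝ) I (fun t => (extChartAt I x).symm (l t)) 0 (1 : ℝ)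
        = mfderiv 𝓘(ℝ, E) I (extChartAt I x).symm (l 0) w := by
      have := mfderiv_comp (I := 𝓘(ℝ, ℝ)) (I' := 𝓘(ℝ, E)) (I'' := I) (f := l)
        (g := (extChartAt I x).symm) (0 : ℝ) (by rw [hl0]; exact hsd)
        (hlC.contMDiff.contMDiffAt.mdifferentiableAt (by simp))
      refine (congrArg (fun L => L (1 : ℝ)) this).trans ?_
      exact congrArg (mfderiv 𝓘(ℝ, E) I (extChartAt I x).symm (l 0)) hlv
    have h2 := mfderivWithin_extChartAt_symm_comp_mfderiv_extChartAt'
      (mem_extChartAt_source (I := I) x)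
    rw [I.range_eq_univ, mfderivWithin_univ] at h2
    refine Bundle.TotalSpace.ext hγ0 (heq_of_eq (h1.trans ?_))
    rw [hl0]
    exact congrArg (fun L => L v) h2

/-- A smooth map with values in `S` has differential with values in the tangent spaces of `S`. -/
theorem mfderiv_mem_tangentTo [I.Boundaryless] [IsManifold I ∞ X] {E' A' Z : Type*}
    [NormedAddCommGroup E'] [NormedSpace ℝ E'] [TopologicalSpace A'] {J : ModelWithCorners ℝ E' A'}
    [TopologicalSpace Z] [ChartedSpace A' Z]
    {f : X → Z} (hf : ContMDiff I J ∞ f) {S : Set Z} (hS : ∀ x, f x ∈ S) (x : X)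
    (v : TangentSpace I x) : mfderiv I J f x v ∈ tangentTo J S (f x) := by
  obtain ⟨γ, hγ, h0, hv⟩ := exists_curve x v
  subst h0
  obtain rfl := eq_of_heq (Bundle.TotalSpace.mk.inj hv).2
  refine Submodule.subset_span ⟨f ∘ γ, ?_, ?_⟩
  · filter_upwards [hγ] with t ht
    exact ⟨(hf _).comp t ht, hS _⟩
  · rw [mfderiv_comp (0 : ℝ) (hf.mdifferentiable (by simp) _)
      (hγ.self_of_nhds.mdifferentiableAt (by simp))]
    rfl

theorem tangentTo_univ [I.Boundaryless] [IsManifold I ∞ X] (x : X) : tangentTo I univ x = ⊤ := by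
  refine eq_top_iff.2 fun v _ => ?_
  have := mfderiv_mem_tangentTo (contMDiff_id (I := I) (M := X) (n := ∞)) (S := univ)
    (fun _ => mem_univ _) x v
  rwa [mfderiv_id] at this

/-! ### Brackets of vector fields mapped into a distribution -/

/-- The Leibniz rule for a family of linear maps applied to a family of vectors. -/
theorem mfderiv_clm_apply_apply {F' : Type*} [NormedAddCommGroup F'] [NormedSpace ℝ F']
    {T : X → F →L[ℝ] F'} {w : X → F} {x : X}
    (hT : MDifferentiableAt I 𝓘(ℝ, F →L[ℝ] F') T x) (hw : MDifferentiableAt I 𝓘(ℝ, F) w x)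
    (u : TangentSpace I x) :
    differential I (fun y => T y (w y)) x u
      = differential I T x u (w x) + T x (differential I w x u) := by
  have hB := ((isBoundedBilinearMap_apply (𝕜 := ℝ) (E := F) (F := F')).hasFDerivAt
    (T x, w x)).hasMFDerivAt
  have hTw : HasMFDerivAt I 𝓘(ℝ, (F →L[ℝ] F') × F) (fun y => (T y, w y)) x
      ((differential I T x).prod (differential I w x)) :=
    ⟨hT.hasMFDerivAt.1.prodMk hw.hasMFDerivAt.1, hT.hasMFDerivAt.2.prodMk hw.hasMFDerivAt.2⟩
  have h := HasMFDerivAt.comp x hB hTw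
  have := congrArg (fun L => L u) h.mfderiv
  refine Eq.trans this ?_
  exact add_comm (T x (differential I w x u)) _

/-- Cartan's formula `ω([U, V]) = -dω(U, V)` for the pull-back `ω` to `X`, along `f`, of the form
`Θ ∘ dc` on `Y`, when `ω(U)` and `ω(V)` vanish along a set `S` to which `U x` and `V x` are tangent.
The right-hand side depends on `df(U x)` and `df(V x)` only. -/
theorem form_mlieBracket [CompleteSpace E] [I.Boundaryless] [IsManifold I ∞ X]
    [IsManifold 𝓘(ℝ, EY) ∞ Y] {F' : Type*} [NormedAddCommGroup F'] [NormedSpace ℝ F']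
    {f : X → Y} {x : X} (hf : ContMDiffAt I 𝓘(ℝ, EY) ∞ f x)
    {Θ : Y → F →L[ℝ] F'} (hΘ : ContMDiffAt 𝓘(ℝ, EY) 𝓘(ℝ, F →L[ℝ] F') ∞ Θ (f x))
    {c : Y → F} (hc : ContMDiffAt 𝓘(ℝ, EY) 𝓘(ℝ, F) ∞ c (f x))
    {S : Set X} {U V : ∀ y : X, TangentSpace I y}
    (hU : ContMDiffAt I I.tangent ∞ (fun y => (⟨y, U y⟩ : TangentBundle I X)) x)
    (hV : ContMDiffAt I I.tangent ∞ (fun y => (⟨y, V y⟩ : TangentBundle I X)) x)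
    (hUS : ∀ᶠ y in 𝓝 x, y ∈ S →
      Θ (f y) (differential 𝓘(ℝ, EY) c (f y) (mfderiv I 𝓘(ℝ, EY) f y (U y))) = 0)
    (hVS : ∀ᶠ y in 𝓝 x, y ∈ S →
      Θ (f y) (differential 𝓘(ℝ, EY) c (f y) (mfderiv I 𝓘(ℝ, EY) f y (V y))) = 0)
    (hUT : U x ∈ tangentTo I S x) (hVT : V x ∈ tangentTo I S x) :
    Θ (f x) (differential 𝓘(ℝ, EY) c (f x)
        (mfderiv I 𝓘(ℝ, EY) f x (VectorField.mlieBracket I U V x)))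
      = (differential 𝓘(ℝ, EY) Θ (f x) (mfderiv I 𝓘(ℝ, EY) f x (V x)))
          (differential 𝓘(ℝ, EY) c (f x) (mfderiv I 𝓘(ℝ, EY) f x (U x)))
        - (differential 𝓘(ℝ, EY) Θ (f x)
            (mfderiv I 𝓘(ℝ, EY) f x (U x)))
          (differential 𝓘(ℝ, EY) c (f x) (mfderiv I 𝓘(ℝ, EY) f x (V x))) := by
  have hcf : ContMDiffAt I 𝓘(ℝ, F) ∞ (c ∘ f) x := hc.comp x hf
  have hT : ContMDiffAt I 𝓘(ℝ, F →L[ℝ] F') ∞ (Θ ∘ f) x := hΘ.comp x hf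
  have hfd := hf.mdifferentiableAt (by simp)
  have hcomp : ∀ᶠ y in 𝓝 x, ∀ W : ∀ y : X, TangentSpace I y, dirDeriv I (c ∘ f) W y
      = (differential 𝓘(ℝ, EY) c (f y) (mfderiv I 𝓘(ℝ, EY) f y (W y))) := by
    have h1 := (contMDiffAt_iff_contMDiffAt_nhds (n := 1) (by simp)).1 (hf.of_le (by simp))
    have h2 := (contMDiffAt_iff_contMDiffAt_nhds (n := 1) (by simp)).1 (hc.of_le (by simp))
    filter_upwards [h1, hf.continuousAt.eventually h2] with y hy1 hy2 W
    exact congrArg (fun L => L (W y))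
      (mfderiv_comp y (hy2.mdifferentiableAt (by simp)) (hy1.mdifferentiableAt (by simp)))
  -- differentiate `ω(W) = 0`, which holds on `S`, in the direction of `V x`
  have key : ∀ (V W : ∀ y : X, TangentSpace I y),
      ContMDiffAt I I.tangent ∞ (fun y => (⟨y, W y⟩ : TangentBundle I X)) x →
      (∀ᶠ y in 𝓝 x, y ∈ S →
        Θ (f y) (differential 𝓘(ℝ, EY) c (f y) (mfderiv I 𝓘(ℝ, EY) f y (W y))) = 0) →
      V x ∈ tangentTo I S x →
      (differential 𝓘(ℝ, EY) Θ (f x) (mfderiv I 𝓘(ℝ, EY) f x (V x)))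
          (differential 𝓘(ℝ, EY) c (f x) (mfderiv I 𝓘(ℝ, EY) f x (W x)))
        + Θ (f x) (dirDeriv I (dirDeriv I (c ∘ f) W) V x) = 0 := by
    intro V W hW hWS hVT
    have hw := (contMDiffAt_dirDeriv hcf hW).mdifferentiableAt (by simp)
    have hTd := hT.mdifferentiableAt (by simp)
    have h0 : differential I (fun y => (Θ ∘ f) y (dirDeriv I (c ∘ f) W y)) x (V x) = 0 := by
      refine mfderiv_eq_zero_of_mem_tangentTo
        ((hT.clm_apply (contMDiffAt_dirDeriv hcf hW)).mdifferentiableAt (by simp)) ?_ hVT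
      filter_upwards [hWS, hcomp] with y hy1 hy2 hyS
      rw [hy2]
      exact hy1 hyS
    have h1 := (mfderiv_clm_apply_apply hTd hw (V x)).symm.trans h0
    rw [hcomp.self_of_nhds] at h1
    refine Eq.trans ?_ h1
    refine congrArg₂ _ (congrArg (fun L : F →L[ℝ] F' => L _) ?_) rfl
    exact (congrArg (fun L => L (V x)) (mfderiv_comp x (hΘ.mdifferentiableAt (by simp)) hfd)).symm
  have hUV := key U V hV hVS hUT
  have hVU := key V U hU hUS hVT
  have hbr := dirDeriv_mlieBracket hcf hU hV
  rw [hcomp.self_of_nhds] at hbr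
  rw [hbr, map_sub, eq_neg_of_add_eq_zero_right hUV, eq_neg_of_add_eq_zero_right hVU]
  abel

/-- Let `f : X → Y` and let `H` be a distribution on `Y`. If `df` maps the vector fields `U`, `V`
into `H` along a set to which they are tangent at `x`, then the class of `df([U, V]_x)` modulo `H`
depends only on `df(U_x)` and `df(V_x)`: it vanishes as soon as `[U', V']` is in `H` at `f x` for
some sections `U'`, `V'` of `H` with these values. -/
theorem mfderiv_mlieBracket_mem [CompleteSpace E] [I.Boundaryless] [IsManifold I ∞ X]
    [FiniteDimensional ℝ EY] [IsManifold 𝓘(ℝ, EY) ∞ Y]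
    {f : X → Y} {x : X} (hf : ContMDiffAt I 𝓘(ℝ, EY) ∞ f x)
    {H : ∀ y : Y, Submodule ℝ (TangentSpace 𝓘(ℝ, EY) y)} (hH : IsSmoothDistribution 𝓘(ℝ, EY) H)
    {S : Set X} {U V : ∀ y : X, TangentSpace I y}
    (hU : ContMDiffAt I I.tangent ∞ (fun y => (⟨y, U y⟩ : TangentBundle I X)) x)
    (hV : ContMDiffAt I I.tangent ∞ (fun y => (⟨y, V y⟩ : TangentBundle I X)) x)
    (hUS : ∀ᶠ y in 𝓝 x, y ∈ S → mfderiv I 𝓘(ℝ, EY) f y (U y) ∈ H (f y))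
    (hVS : ∀ᶠ y in 𝓝 x, y ∈ S → mfderiv I 𝓘(ℝ, EY) f y (V y) ∈ H (f y))
    (hUT : U x ∈ tangentTo I S x) (hVT : V x ∈ tangentTo I S x)
    {U' V' : ∀ y : Y, TangentSpace 𝓘(ℝ, EY) y}
    (hU' : IsLocalSection 𝓘(ℝ, EY) univ H (f x) U') (hV' : IsLocalSection 𝓘(ℝ, EY) univ H (f x) V')
    (hUU' : U' (f x) = mfderiv I 𝓘(ℝ, EY) f x (U x))
    (hVV' : V' (f x) = mfderiv I 𝓘(ℝ, EY) f x (V x))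
    (hbr : VectorField.mlieBracket 𝓘(ℝ, EY) U' V' (f x) ∈ H (f x)) :
    mfderiv I 𝓘(ℝ, EY) f x (VectorField.mlieBracket I U V x) ∈ H (f x) := by
  have : CompleteSpace EY := FiniteDimensional.complete ℝ EY
  obtain ⟨Θ, hΘ, hΘH⟩ := hH.exists_form (f x)
  have hc : ContMDiffAt 𝓘(ℝ, EY) 𝓘(ℝ, EY) ∞ (extChartAt 𝓘(ℝ, EY) (f x)) (f x) :=
    contMDiffAt_extChartAt
  have hΘf := hf.continuousAt.eventually hΘH
  have h1 := form_mlieBracket hf hΘ hc hU hV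
    (by filter_upwards [hΘf, hUS] with y hy1 hy2 hyS using (hy1 _).1 (hy2 hyS))
    (by filter_upwards [hΘf, hVS] with y hy1 hy2 hyS using (hy1 _).1 (hy2 hyS)) hUT hVT
  have hid : ∀ y (v : TangentSpace 𝓘(ℝ, EY) y), mfderiv 𝓘(ℝ, EY) 𝓘(ℝ, EY) (id : Y → Y) y v = v :=
    fun y v => by rw [mfderiv_id]; rfl
  -- the same formula on `Y` itself, for the sections `U'` and `V'`
  have h2 := form_mlieBracket (f := (id : Y → Y)) (x := f x) contMDiffAt_id hΘ hc
    hU'.self_of_nhds.1 hV'.self_of_nhds.1 (S := univ)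
    (by
      filter_upwards [hΘH, hU'] with y hy1 hy2 hyS
      rw [hid]
      exact (hy1 _).1 (hy2.2 hyS))
    (by
      filter_upwards [hΘH, hV'] with y hy1 hy2 hyS
      rw [hid]
      exact (hy1 _).1 (hy2.2 hyS))
    (by rw [tangentTo_univ]; trivial) (by rw [tangentTo_univ]; trivial)
  have hΘx := hΘH.self_of_nhds
  rw [hid, hid, hid, hUU', hVV'] at h2
  exact (hΘx _).2 (h1.trans (h2.symm.trans ((hΘx _).1 hbr)))

end LocalEquations

/-! ### Lifts to the bundle of linear maps -/

section Lifts

/-- On a subspace `K` on which `a` is surjective, a linear map that vanishes on `K ∩ ker a` factors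
through `a`. -/
theorem exists_factor_on {V W W' : Type*} [AddCommGroup V] [Module ℝ V] [AddCommGroup W]
    [Module ℝ W] [AddCommGroup W'] [Module ℝ W'] (K : Submodule ℝ V) (a : V →ₗ[ℝ] W)
    (b : V →ₗ[ℝ] W') (ha : ∀ y, ∃ k ∈ K, a k = y) (hab : ∀ k ∈ K, a k = 0 → b k = 0) :
    ∃ z : W →ₗ[ℝ] W', ∀ k ∈ K, z (a k) = b k := by
  obtain ⟨s, hs⟩ := (a.domRestrict K).exists_rightInverse_of_surjective
    (LinearMap.range_eq_top.2 fun y => by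
      obtain ⟨k, hk, rfl⟩ := ha y
      exact ⟨⟨k, hk⟩, rfl⟩)
  refine ⟨(b.domRestrict K).comp s, fun k hk => ?_⟩
  have h1 : a (s (a k)) = a k := LinearMap.congr_fun hs (a k)
  have h2 := hab (s (a k) - k) (K.sub_mem (s (a k)).2 hk) (by rw [map_sub, h1, sub_self])
  rw [map_sub] at h2
  exact sub_eq_zero.1 h2

variable {EM : Type*} [NormedAddCommGroup EM] [NormedSpace ℝ EM]
  {M : Type*} [TopologicalSpace M] [ChartedSpace EM M]
  {EP : Type*} [NormedAddCommGroup EP] [NormedSpace ℝ EP]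
  {P : Type*} [TopologicalSpace P] [ChartedSpace EP P]
  {EQ : Type*} [NormedAddCommGroup EQ] [NormedSpace ℝ EQ]
  {Q : Type*} [TopologicalSpace Q] [ChartedSpace EQ Q]
  {π : C^∞⟮𝓘(ℝ, EP), P; 𝓘(ℝ, EM), M⟯}
  {K : ∀ q : Q, Submodule ℝ (TangentSpace 𝓘(ℝ, EQ) q)} {φ : Q → P}

theorem IsPfaffianFibration.exists_mem_mfderiv_eq [IsManifold 𝓘(ℝ, EQ) ∞ Q] {πQ : Q → M}
    (hQ : IsPfaffianFibration (EM := EM) πQ K) (q : Q) (Y : TangentSpace 𝓘(ℝ, EM) (πQ q)) :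
    ∃ k ∈ K q, mfderiv 𝓘(ℝ, EQ) 𝓘(ℝ, EM) πQ q k = Y := by
  obtain ⟨v, rfl⟩ := hQ.fibration.submersion q Y
  have hv : v ∈ K q ⊔ vertical (EM := EM) πQ q := by rw [hQ.transversal q]; trivial
  obtain ⟨k, hk, w, hw, rfl⟩ := Submodule.mem_sup.1 hv
  refine ⟨k, hk, ?_⟩
  have : mfderiv 𝓘(ℝ, EQ) 𝓘(ℝ, EM) πQ q w = 0 := hw
  rw [map_add, this, add_zero]

theorem homBundle_ext {j j' : HomBundle π} (hp : pr π j = pr π j')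
    (hz : ∀ Y : EM, (zeta j : EM →L[ℝ] EP) Y = (zeta j' : EM →L[ℝ] EP) Y) : j = j' := by
  obtain ⟨p, z⟩ := j
  obtain ⟨p', z'⟩ := j'
  obtain rfl : p = p' := hp
  congr 1
  exact ContinuousLinearMap.ext hz

variable [IsManifold 𝓘(ℝ, EM) ∞ M] [IsManifold 𝓘(ℝ, EP) ∞ P]

theorem contMDiff_pr : ContMDiff (homModel EM EP) 𝓘(ℝ, EP) ∞ (pr π) :=
  Bundle.contMDiff_proj (n := ∞) (fun p : P =>
    Bundle.Pullback π (TangentSpace 𝓘(ℝ, EM) : M → Type _) p →L[ℝ] TangentSpace 𝓘(ℝ, EP) p)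

/-- For a lift `Ψ` of `φ` to the `Hom` bundle, `dΨ(v)` is in the kernel of the Cartan form if and
only if the linear map `ζ` at `Ψ q` maps `d(π ∘ φ)(v)` to `dφ(v)`. -/
theorem cartanForm_mfderiv_eq_zero_iff {Ψ : Q → HomBundle π} {q : Q}
    (hΨ : MDifferentiableAt 𝓘(ℝ, EQ) (homModel EM EP) Ψ q) (hpr : ∀ q, pr π (Ψ q) = φ q)
    (v : TangentSpace 𝓘(ℝ, EQ) q) :
    cartanForm (Ψ q) (mfderiv 𝓘(ℝ, EQ) (homModel EM EP) Ψ q v) = 0 ↔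
      (zeta (Ψ q) : EM →L[ℝ] EP) (mfderiv 𝓘(ℝ, EQ) 𝓘(ℝ, EM) (fun q => π (φ q)) q v : EM)
        = (mfderiv 𝓘(ℝ, EQ) 𝓘(ℝ, EP) φ q v : EP) := by
  obtain rfl : (fun q => pr π (Ψ q)) = φ := funext hpr
  have h1 := congrArg (fun L => L v) (mfderiv_comp q
    (contMDiff_pr.mdifferentiable (by simp) (Ψ q)) hΨ)
  have h2 := congrArg (fun L => L v) (mfderiv_comp (g := fun j => π (pr π j)) q
    ((π.contMDiff.comp contMDiff_pr).mdifferentiable (by simp) (Ψ q)) hΨ)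
  have h3 : cartanForm (Ψ q) (mfderiv 𝓘(ℝ, EQ) (homModel EM EP) Ψ q v)
      = mfderiv 𝓘(ℝ, EQ) 𝓘(ℝ, EP) (fun q => pr π (Ψ q)) q v
        - zeta (Ψ q) (mfderiv 𝓘(ℝ, EQ) 𝓘(ℝ, EM) (fun q => π (pr π (Ψ q))) q v) := by
    refine congrArg₂ _ h1.symm ?_
    exact congrArg (zeta (Ψ q)) h2.symm
  rw [h3, sub_eq_zero]
  exact eq_comm

/-- A lift of `φ` which maps `K` to the kernel of the Cartan form is determined by `φ`. -/
theorem lift_unique [IsManifold 𝓘(ℝ, EQ) ∞ Q]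
    (hQ : IsPfaffianFibration (EM := EM) (fun q => π (φ q)) K)
    {Ψ Ψ' : Q → HomBundle π} (hΨ : MDifferentiable 𝓘(ℝ, EQ) (homModel EM EP) Ψ)
    (hΨ' : MDifferentiable 𝓘(ℝ, EQ) (homModel EM EP) Ψ')
    (hpr : ∀ q, pr π (Ψ q) = φ q) (hpr' : ∀ q, pr π (Ψ' q) = φ q)
    (hK : ∀ q, ∀ v ∈ K q, cartanForm (Ψ q) (mfderiv 𝓘(ℝ, EQ) (homModel EM EP) Ψ q v) = 0)
    (hK' : ∀ q, ∀ v ∈ K q, cartanForm (Ψ' q) (mfderiv 𝓘(ℝ, EQ) (homModel EM EP) Ψ' q v) = 0) :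
    Ψ = Ψ' := by
  funext q
  refine homBundle_ext ((hpr q).trans (hpr' q).symm) fun Y => ?_
  obtain ⟨k, hk, rfl⟩ := hQ.exists_mem_mfderiv_eq q Y
  exact ((cartanForm_mfderiv_eq_zero_iff (hΨ q) hpr k).1 (hK q k hk)).trans
    ((cartanForm_mfderiv_eq_zero_iff (hΨ' q) hpr' k).1 (hK' q k hk)).symm

/-- The family of maps `ζ` with `ζ ∘ d(π ∘ φ) = dφ` on `K` is smooth. In local trivializations, a
frame of `K` turns `d(π ∘ φ)` and `dφ` into smooth matrices `A` and `B` with `ζ A = B`; if `R` is a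
right inverse of `A` at one point, then `ζ = B R (A R)⁻¹` near that point. -/
theorem contMDiffAt_lift [IsManifold 𝓘(ℝ, EQ) ∞ Q] [FiniteDimensional ℝ EM]
    (hQ : IsPfaffianFibration (EM := EM) (fun q => π (φ q)) K)
    (hφ : ContMDiff 𝓘(ℝ, EQ) 𝓘(ℝ, EP) ∞ φ)
    (ζ : ∀ q, Bundle.Pullback π (TangentSpace 𝓘(ℝ, EM) : M → Type _) (φ q) →L[ℝ]
      TangentSpace 𝓘(ℝ, EP) (φ q))
    (hζ : ∀ q, ∀ k ∈ K q, ζ q (mfderiv 𝓘(ℝ, EQ) 𝓘(ℝ, EM) (fun q => π (φ q)) q k)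
      = mfderiv 𝓘(ℝ, EQ) 𝓘(ℝ, EP) φ q k) (q₀ : Q) :
    ContMDiffAt 𝓘(ℝ, EQ) (homModel EM EP) ∞ (fun q => (⟨φ q, ζ q⟩ : HomBundle π)) q₀ := by
  have hπφ : ContMDiff 𝓘(ℝ, EQ) 𝓘(ℝ, EM) ∞ (fun q => π (φ q)) := π.contMDiff.comp hφ
  rw [contMDiffAt_hom_bundle]
  refine ⟨hφ q₀, ?_⟩
  obtain ⟨k, W, hW⟩ := hQ.smooth q₀
  have hW₀ := hW.self_of_nhds
  set eM := trivializationAt EM (Bundle.Pullback π (TangentSpace 𝓘(ℝ, EM) : M → Type _)) (φ q₀)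
  set eP := trivializationAt EP (TangentSpace 𝓘(ℝ, EP) : P → Type _) (φ q₀)
  let a : Fin k → Q → EM := fun i q =>
    (eM ⟨φ q, mfderiv 𝓘(ℝ, EQ) 𝓘(ℝ, EM) (fun q => π (φ q)) q (W i q)⟩).2
  let b : Fin k → Q → EP := fun i q =>
    (eP ⟨φ q, mfderiv 𝓘(ℝ, EQ) 𝓘(ℝ, EP) φ q (W i q)⟩).2
  have ha : ∀ i, ContMDiffAt 𝓘(ℝ, EQ) 𝓘(ℝ, EM) ∞ (a i) q₀ := fun i =>
    (Bundle.contMDiffAt_totalSpace.1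
      ((hπφ.contMDiff_tangentMap (m := ∞) (by simp)).contMDiffAt.comp q₀ (hW₀.1 i))).2
  have hb : ∀ i, ContMDiffAt 𝓘(ℝ, EQ) 𝓘(ℝ, EP) ∞ (b i) q₀ := fun i =>
    (Bundle.contMDiffAt_totalSpace.1
      ((hφ.contMDiff_tangentMap (m := ∞) (by simp)).contMDiffAt.comp q₀ (hW₀.1 i))).2
  have hM : ∀ᶠ q in 𝓝 q₀, φ q ∈ eM.baseSet :=
    hφ.continuous.continuousAt.eventually
      (eM.open_baseSet.mem_nhds (FiberBundle.mem_baseSet_trivializationAt' (φ q₀)))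
  have hP : ∀ᶠ q in 𝓝 q₀, φ q ∈ eP.baseSet :=
    hφ.continuous.continuousAt.eventually
      (eP.open_baseSet.mem_nhds (FiberBundle.mem_baseSet_trivializationAt' (φ q₀)))
  have hA := contMDiffAt_columns ha
  have hB := contMDiffAt_columns hb
  have haL : ∀ q, φ q ∈ eM.baseSet → ∀ i, a i q = eM.continuousLinearMapAt ℝ (φ q)
      (mfderiv 𝓘(ℝ, EQ) 𝓘(ℝ, EM) (fun q => π (φ q)) q (W i q)) := fun q hq i =>
    (eM.continuousLinearMapAt_apply_of_mem ℝ hq _).symm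
  have hbL : ∀ q, φ q ∈ eP.baseSet → ∀ i, b i q = eP.continuousLinearMapAt ℝ (φ q)
      (mfderiv 𝓘(ℝ, EQ) 𝓘(ℝ, EP) φ q (W i q)) := fun q hq i =>
    (eP.continuousLinearMapAt_apply_of_mem ℝ hq _).symm
  set Z : Q → EM →L[ℝ] EP := fun q => ContinuousLinearMap.inCoordinates EM
    (Bundle.Pullback π (TangentSpace 𝓘(ℝ, EM) : M → Type _)) EP
    (TangentSpace 𝓘(ℝ, EP) : P → Type _) (φ q₀) (φ q) (φ q₀) (φ q) (ζ q)
  -- the coordinate expression of `ζ` maps the columns `a i` to the columns `b i`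
  have hZa : ∀ᶠ q in 𝓝 q₀,
      (Z q).comp (columns fun i => a i q) = columns fun i => b i q := by
    filter_upwards [hM, hP, hW] with q hqM hqP hqW
    ext1 c
    rw [ContinuousLinearMap.comp_apply, columns_apply, columns_apply, map_sum]
    refine Finset.sum_congr rfl fun i _ => ?_
    have hWK : W i q ∈ K q := by
      rw [hqW.2.2]; exact Submodule.subset_span (mem_range_self i)
    rw [map_smul]
    congr 1
    refine Eq.trans (b := eP.continuousLinearMapAt ℝ (φ q)
      (ζ q (eM.symmL ℝ (φ q) (a i q)))) rfl ?_
    rw [haL q hqM, hbL q hqP]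
    exact congrArg (eP.continuousLinearMapAt ℝ (φ q))
      ((congrArg (ζ q) (eM.symmL_continuousLinearMapAt hqM _)).trans (hζ q _ hWK))
  have hsurj : LinearMap.range (columns fun i => a i q₀).toLinearMap = ⊤ := by
    refine LinearMap.range_eq_top.2 fun y => ?_
    obtain ⟨w, hw, hwy⟩ := hQ.exists_mem_mfderiv_eq q₀ (eM.symmL ℝ (φ q₀) y)
    rw [hW₀.2.2] at hw
    obtain ⟨c, rfl⟩ := (Submodule.mem_span_range_iff_exists_fun ℝ).1 hw
    refine ⟨c, ?_⟩
    have h1 : eM.continuousLinearMapAt ℝ (φ q₀)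
        (mfderiv 𝓘(ℝ, EQ) 𝓘(ℝ, EM) (fun q => π (φ q)) q₀ (∑ i, c i • W i q₀)) = y := by
      refine (congrArg _ hwy).trans ?_
      exact eM.continuousLinearMapAt_symmL hM.self_of_nhds y
    refine Eq.trans ?_ h1
    refine (columns_apply _ c).trans ?_
    rw [map_sum]
    refine Eq.trans ?_ (map_sum (eM.continuousLinearMapAt ℝ (φ q₀)) _ _).symm
    refine Finset.sum_congr rfl fun i _ => ?_
    rw [map_smul, haL q₀ hM.self_of_nhds]
    exact (map_smul (eM.continuousLinearMapAt ℝ (φ q₀)) _ _).symm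
  obtain ⟨R, hR⟩ := (columns fun i => a i q₀).toLinearMap.exists_rightInverse_of_surjective hsurj
  let R' : EM →L[ℝ] (Fin k → ℝ) := LinearMap.toContinuousLinearMap R
  have hAR : ContMDiffAt 𝓘(ℝ, EQ) 𝓘(ℝ, EM →L[ℝ] EM) ∞
      (fun q => (columns fun i => a i q).comp R') q₀ := hA.clm_comp contMDiffAt_const
  have hAR₀ : ((columns fun i => a i q₀).comp R')
      = ((ContinuousLinearEquiv.refl ℝ EM : EM ≃L[ℝ] EM) : EM →L[ℝ] EM) := by
    ext1 y; exact LinearMap.congr_fun hR y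
  have hunit : ((columns fun i => a i q₀).comp R').IsInvertible := ⟨_, hAR₀.symm⟩
  have : CompleteSpace EM := FiniteDimensional.complete ℝ EM
  have hinv : ContMDiffAt 𝓘(ℝ, EQ) 𝓘(ℝ, EM →L[ℝ] EM) ∞
      (fun q => ((columns fun i => a i q).comp R').inverse) q₀ :=
    ContMDiffAt.comp q₀ (g := ContinuousLinearMap.inverse)
      hunit.contDiffAt_map_inverse.contMDiffAt hAR
  have hev : ∀ᶠ q in 𝓝 q₀, ((columns fun i => a i q).comp R').IsInvertible := by
    have h1 := (ContinuousLinearEquiv.refl ℝ EM : EM ≃L[ℝ] EM).nhds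
    rw [← hAR₀] at h1
    exact hAR.continuousAt.eventually h1
  -- hence `Z = B R (A R)⁻¹` near `q₀`
  refine (hB.clm_comp (ContMDiffAt.clm_comp (contMDiffAt_const (c := R')) hinv)
    ).congr_of_eventuallyEq ?_
  filter_upwards [hev, hZa] with q hq hqZ
  change Z q = _
  rw [← hqZ, ContinuousLinearMap.comp_assoc, ← ContinuousLinearMap.comp_assoc _ R',
    hq.self_comp_inverse, ContinuousLinearMap.comp_id]

end Lifts

/-! ### The curvature along a map -/

section Curvature

variable {EY : Type*} [NormedAddCommGroup EY] [NormedSpace ℝ EY]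
  {Y : Type*} [TopologicalSpace Y] [ChartedSpace EY Y] [IsManifold 𝓘(ℝ, EY) ∞ Y]

/-- Every vector of a smooth distribution extends to a local section. -/
theorem IsSmoothDistribution.exists_localSection
    {H : ∀ y : Y, Submodule ℝ (TangentSpace 𝓘(ℝ, EY) y)}
    (hH : IsSmoothDistribution 𝓘(ℝ, EY) H) {y : Y} {u : TangentSpace 𝓘(ℝ, EY) y} (hu : u ∈ H y) :
    ∃ U, IsLocalSection 𝓘(ℝ, EY) univ H y U ∧ U y = u := by
  obtain ⟨k, W, hW⟩ := hH y
  rw [hW.self_of_nhds.2.2] at hu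
  obtain ⟨c, rfl⟩ := (Submodule.mem_span_range_iff_exists_fun ℝ).1 hu
  refine ⟨fun z => ∑ i, c i • W i z, ?_, rfl⟩
  filter_upwards [hW] with z hz
  refine ⟨?_, fun _ => ?_⟩
  · exact ContMDiffAt.sum_section fun i _ => ContMDiffAt.const_smul_section (hz.1 i)
  · rw [hz.2.2]
    exact Submodule.sum_mem _ fun i _ =>
      Submodule.smul_mem _ _ (Submodule.subset_span (mem_range_self i))

theorem exists_mlieBracket_mem_of_curvature_eq_zero
    {H : ∀ y : Y, Submodule ℝ (TangentSpace 𝓘(ℝ, EY) y)}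
    (hH : IsSmoothDistribution 𝓘(ℝ, EY) H) {y : Y} {u v : TangentSpace 𝓘(ℝ, EY) y}
    (hu : u ∈ H y) (hv : v ∈ H y) (h0 : curvature 𝓘(ℝ, EY) H y u v = 0) :
    ∃ U V, IsLocalSection 𝓘(ℝ, EY) univ H y U ∧ IsLocalSection 𝓘(ℝ, EY) univ H y V ∧
      U y = u ∧ V y = v ∧ VectorField.mlieBracket 𝓘(ℝ, EY) U V y ∈ H y := by
  obtain ⟨U, hU, hUu⟩ := hH.exists_localSection hu
  obtain ⟨V, hV, hVv⟩ := hH.exists_localSection hv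
  have h : ∃ UV : (∀ z : Y, TangentSpace 𝓘(ℝ, EY) z) × (∀ z : Y, TangentSpace 𝓘(ℝ, EY) z),
      IsLocalSection 𝓘(ℝ, EY) univ H y UV.1 ∧ IsLocalSection 𝓘(ℝ, EY) univ H y UV.2 ∧
        UV.1 y = u ∧ UV.2 y = v := ⟨(U, V), hU, hV, hUu, hVv⟩
  rw [curvature, curvatureAlong, dif_pos h] at h0
  have hs := h.choose_spec
  exact ⟨_, _, hs.1, hs.2.1, hs.2.2.1, hs.2.2.2, (Submodule.Quotient.mk_eq_zero _).1 h0⟩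

/-- Let `D` be tangent to a subset `S` of `X` at `x` and be mapped into `H` by `df` along `S`. Then
`[df] ∘ κ_D = f^* κ_H`, in the form: the left-hand side vanishes where the right-hand side does. -/
theorem normalMap_curvatureAlong_eq_zero {E : Type*} [NormedAddCommGroup E] [NormedSpace ℝ E]
    [CompleteSpace E] {A : Type*} [TopologicalSpace A] {I : ModelWithCorners ℝ E A}
    [I.Boundaryless] {X : Type*} [TopologicalSpace X] [ChartedSpace A X] [IsManifold I ∞ X]
    [FiniteDimensional ℝ EY]
    {f : X → Y} (hf : ContMDiff I 𝓘(ℝ, EY) ∞ f)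
    {H : ∀ y : Y, Submodule ℝ (TangentSpace 𝓘(ℝ, EY) y)} (hH : IsSmoothDistribution 𝓘(ℝ, EY) H)
    {S : Set X} {D : ∀ x : X, Submodule ℝ (TangentSpace I x)}
    (hS : ∀ x ∈ S, ∀ v ∈ D x, mfderiv I 𝓘(ℝ, EY) f x v ∈ H (f x)) {x : X} (hx : x ∈ S)
    (hT : D x ≤ tangentTo I S x) (h : ∀ v ∈ D x, mfderiv I 𝓘(ℝ, EY) f x v ∈ H (f x))
    {u v : TangentSpace I x} (h0 : curvature 𝓘(ℝ, EY) H (f x) (mfderiv I 𝓘(ℝ, EY) f x u)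
      (mfderiv I 𝓘(ℝ, EY) f x v) = 0) :
    normalMap f D H x h (curvatureAlong I S D x u v) = 0 := by
  unfold curvatureAlong
  split_ifs with hex
  · obtain ⟨hU, hV, hUu, hVv⟩ := hex.choose_spec
    generalize hex.choose = UV at *
    have hUD := hU.self_of_nhds.2 hx
    have hVD := hV.self_of_nhds.2 hx
    have hu := hS x hx _ hUD
    have hv := hS x hx _ hVD
    rw [← hUu, ← hVv] at h0
    obtain ⟨U', V', hU', hV', hUU', hVV', hbr⟩ :=
      exists_mlieBracket_mem_of_curvature_eq_zero hH hu hv h0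
    refine (Submodule.Quotient.mk_eq_zero _).2 ?_
    exact mfderiv_mlieBracket_mem (hf x) hH hU.self_of_nhds.1 hV.self_of_nhds.1
      (hU.mono fun y hy hyS => hS y hyS _ (hy.2 hyS))
      (hV.mono fun y hy hyS => hS y hyS _ (hy.2 hyS)) (hT hUD) (hT hVD) hU' hV' hUU' hVV' hbr
  -- without local sections through `u` and `v`, the curvature is `0` by convention
  · exact map_zero _

end Curvature

/-! ### The lift defined by a prolongation -/

section Prolongations

variable {EM : Type*} [NormedAddCommGroup EM] [NormedSpace ℝ EM]
  {M : Type*} [TopologicalSpace M] [ChartedSpace EM M]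
  {EP : Type*} [NormedAddCommGroup EP] [NormedSpace ℝ EP]
  {P : Type*} [TopologicalSpace P] [ChartedSpace EP P] [IsManifold 𝓘(ℝ, EP) ∞ P]
  {EQ : Type*} [NormedAddCommGroup EQ] [NormedSpace ℝ EQ]
  {Q : Type*} [TopologicalSpace Q] [ChartedSpace EQ Q]
  {π : C^∞⟮𝓘(ℝ, EP), P; 𝓘(ℝ, EM), M⟯}
  {H : ∀ p : P, Submodule ℝ (TangentSpace 𝓘(ℝ, EP) p)}
  {K : ∀ q : Q, Submodule ℝ (TangentSpace 𝓘(ℝ, EQ) q)} {φ : Q → P}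

/-- The curvature condition on a prolongation `φ`, for a factorisation `φ = f ∘ g`. -/
theorem IsProlongation.curvature_comp_eq_zero {E : Type*} [NormedAddCommGroup E] [NormedSpace ℝ E]
    {A : Type*} [TopologicalSpace A] {I : ModelWithCorners ℝ E A}
    {X : Type*} [TopologicalSpace X] [ChartedSpace A X] {πQ : Q → M}
    (hφ : IsProlongation (EM := EM) πQ K π H φ) {f : X → P} {g : Q → X}
    (hf : MDifferentiable I 𝓘(ℝ, EP) f) (hg : MDifferentiable 𝓘(ℝ, EQ) I g)
    (hfg : ∀ q, f (g q) = φ q) {q : Q} {u v : TangentSpace 𝓘(ℝ, EQ) q} (hu : u ∈ K q)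
    (hv : v ∈ K q) :
    curvature 𝓘(ℝ, EP) H (f (g q)) (mfderiv I 𝓘(ℝ, EP) f (g q) (mfderiv 𝓘(ℝ, EQ) I g q u))
      (mfderiv I 𝓘(ℝ, EP) f (g q) (mfderiv 𝓘(ℝ, EQ) I g q v)) = 0 := by
  obtain rfl : f ∘ g = φ := funext hfg
  have h := hφ.curvature_eq_zero q u hu v hv
  rw [mfderiv_comp q (hf _) (hg q)] at h
  exact h

variable [IsManifold 𝓘(ℝ, EM) ∞ M]

/-- A map `Ψ` to a manifold `N` over the `Hom` bundle maps `v` to the pull-back of the kernel of the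
Cartan form if and only if `ι ∘ Ψ` maps `v` to this kernel. -/
theorem mfderiv_mem_cartanPullback_iff {EN : Type*} [NormedAddCommGroup EN] [NormedSpace ℝ EN]
    {N : Type*} [TopologicalSpace N] [ChartedSpace EN N] {ι : N → HomBundle π} {Ψ : Q → N} {q : Q}
    (hι : MDifferentiableAt 𝓘(ℝ, EN) (homModel EM EP) ι (Ψ q))
    (hΨ : MDifferentiableAt 𝓘(ℝ, EQ) 𝓘(ℝ, EN) Ψ q) (v : TangentSpace 𝓘(ℝ, EQ) q) :
    mfderiv 𝓘(ℝ, EQ) 𝓘(ℝ, EN) Ψ q v ∈ cartanPullback π ι (Ψ q) ↔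
      cartanForm ((ι ∘ Ψ) q) (mfderiv 𝓘(ℝ, EQ) (homModel EM EP) (ι ∘ Ψ) q v) = 0 := by
  rw [mfderiv_comp q hι hΨ]
  rfl

/-- A prolongation `φ` factors through `Prol(P, H)`: the point over `q` is the linear map `ζ` with
`ζ ∘ d(π ∘ φ) = dφ` on `K q`. It exists since `d(π ∘ φ)` is onto on `K q` and since `dφ` vanishes on
the symbol space of `K`. -/
theorem exists_lift [FiniteDimensional ℝ EM] [IsManifold 𝓘(ℝ, EQ) ∞ Q]
    (hQ : IsPfaffianFibration (EM := EM) (fun q => π (φ q)) K)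
    (hφ : IsProlongation (EM := EM) (fun q => π (φ q)) K π H φ) :
    ∃ Φ : Q → HomBundle π, (∀ q, Φ q ∈ classicalProl π H) ∧
      ContMDiff 𝓘(ℝ, EQ) (homModel EM EP) ∞ Φ ∧ (∀ q, pr π (Φ q) = φ q) ∧
      ∀ q, ∀ v ∈ K q, cartanForm (Φ q) (mfderiv 𝓘(ℝ, EQ) (homModel EM EP) Φ q v) = 0 := by
  have hex : ∀ q, ∃ ζ : Bundle.Pullback π (TangentSpace 𝓘(ℝ, EM) : M → Type _) (φ q) →L[ℝ]
      TangentSpace 𝓘(ℝ, EP) (φ q),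
      ∀ k ∈ K q, ζ (mfderiv 𝓘(ℝ, EQ) 𝓘(ℝ, EM) (fun q => π (φ q)) q k)
        = mfderiv 𝓘(ℝ, EQ) 𝓘(ℝ, EP) φ q k := by
    intro q
    obtain ⟨z, hz⟩ := exists_factor_on (V := EQ) (W := EM) (W' := EP) (K q)
      (mfderiv 𝓘(ℝ, EQ) 𝓘(ℝ, EM) (fun q => π (φ q)) q).toLinearMap
      (mfderiv 𝓘(ℝ, EQ) 𝓘(ℝ, EP) φ q).toLinearMap
      (hQ.exists_mem_mfderiv_eq q) (fun k hk h0 => hφ.symbol_le q ⟨h0, hk⟩)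
    exact ⟨(LinearMap.toContinuousLinearMap z : EM →L[ℝ] EP), hz⟩
  choose ζ hζ using hex
  have hC : ContMDiff 𝓘(ℝ, EQ) (homModel EM EP) ∞ (fun q => (⟨φ q, ζ q⟩ : HomBundle π)) :=
    contMDiffAt_lift hQ hφ.fibration.contMDiff ζ hζ
  have hζ' : ∀ q (Y : EM), ∃ k ∈ K q,
      mfderiv 𝓘(ℝ, EQ) 𝓘(ℝ, EM) (fun q => π (φ q)) q k = Y ∧
      zeta (⟨φ q, ζ q⟩ : HomBundle π) Y = mfderiv 𝓘(ℝ, EQ) 𝓘(ℝ, EP) φ q k := by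
    intro q Y
    obtain ⟨k, hk, rfl⟩ := hQ.exists_mem_mfderiv_eq q Y
    exact ⟨k, hk, rfl, hζ q k hk⟩
  refine ⟨fun q => ⟨φ q, ζ q⟩, fun q => ⟨⟨?_, ?_⟩, ?_⟩, hC, fun q => rfl, fun q v hv => ?_⟩
  · intro Y
    obtain ⟨k, hk, hkY, hz⟩ := hζ' q Y
    have := mfderiv_comp q (π.contMDiff.mdifferentiable (by simp) (φ q))
      (hφ.fibration.contMDiff.mdifferentiable (by simp) q)
    have h1 := congrArg (fun L => L k) this
    rw [hz]
    exact h1.symm.trans hkY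
  · intro Y
    obtain ⟨k, hk, -, hz⟩ := hζ' q Y
    rw [hz]
    exact hφ.map_mem q k hk
  · intro Y Y'
    obtain ⟨k, hk, -, hz⟩ := hζ' q Y
    obtain ⟨k', hk', -, hz'⟩ := hζ' q Y'
    rw [hz, hz']
    exact hφ.curvature_eq_zero q k hk k' hk'
  · exact (cartanForm_mfderiv_eq_zero_iff (hC.mdifferentiable (by simp) q) (fun _ => rfl) v).2
      (hζ q v hv)

end Prolongations

end Pfaffian

theorem mainTheorem8
    {EM : Type*} [NormedAddCommGroup EM] [NormedSpace ℝ EM] [FiniteDimensional ℝ EM]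
    {M : Type*} [TopologicalSpace M] [ChartedSpace EM M] [IsManifold 𝓘(ℝ, EM) ∞ M]
    {EP : Type*} [NormedAddCommGroup EP] [NormedSpace ℝ EP] [FiniteDimensional ℝ EP]
    {P : Type*} [TopologicalSpace P] [ChartedSpace EP P] [IsManifold 𝓘(ℝ, EP) ∞ P]
    {EQ : Type*} [NormedAddCommGroup EQ] [NormedSpace ℝ EQ] [FiniteDimensional ℝ EQ]
    {Q : Type*} [TopologicalSpace Q] [ChartedSpace EQ Q] [IsManifold 𝓘(ℝ, EQ) ∞ Q]
    (π : C^∞⟮𝓘(ℝ, EP), P; 𝓘(ℝ, EM), M⟯)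
    (H : ∀ p : P, Submodule ℝ (TangentSpace 𝓘(ℝ, EP) p))
    (hP : Pfaffian.IsPfaffianFibration (EM := EM) π H)
    (πQ : Q → M) (K : ∀ q : Q, Submodule ℝ (TangentSpace 𝓘(ℝ, EQ) q))
    (hQ : Pfaffian.IsPfaffianFibration (EM := EM) πQ K)
    (φ : Q → P) (hφ : Pfaffian.IsProlongation (EM := EM) πQ K π H φ) :
    -- the factorisation through `Prol(P, H) ⊆ J¹_H P`, without any smoothness of `Prol(P, H)`
    (∃ (Φ : Q → Pfaffian.HomBundle π) (hΦ : ∀ q, Φ q ∈ Pfaffian.classicalProl π H),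
      ContMDiff 𝓘(ℝ, EQ) (Pfaffian.homModel EM EP) ∞ Φ ∧
      (∀ q, Pfaffian.pr π (Φ q) = φ q) ∧
      (∀ q, ∀ v ∈ K q,
        mfderiv 𝓘(ℝ, EQ) (Pfaffian.homModel EM EP) Φ q v ∈ Pfaffian.prolDist π H (Φ q)) ∧
      (∀ q, ∀ u ∈ K q, ∀ v ∈ K q,
        Pfaffian.normalMap (Pfaffian.pr π) (Pfaffian.prolDist π H) H (Φ q)
          (Pfaffian.mfderiv_pr_mem (hΦ q).1)
          (Pfaffian.curvatureAlong (Pfaffian.homModel EM EP) (Pfaffian.partialProl π H)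
            (Pfaffian.prolDist π H) (Φ q)
            (mfderiv 𝓘(ℝ, EQ) (Pfaffian.homModel EM EP) Φ q u)
            (mfderiv 𝓘(ℝ, EQ) (Pfaffian.homModel EM EP) Φ q v)) = 0 ∧
        Pfaffian.normalMap φ K H q (hφ.map_mem q)
          (Pfaffian.curvature 𝓘(ℝ, EQ) K q u v) = 0) ∧
      (∀ Ψ : Q → Pfaffian.HomBundle π,
        (∀ q, Ψ q ∈ Pfaffian.partialProl π H) →
        ContMDiff 𝓘(ℝ, EQ) (Pfaffian.homModel EM EP) ∞ Ψ →
        (∀ q, Pfaffian.pr π (Ψ q) = φ q) →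
        (∀ q, ∀ v ∈ K q,
          mfderiv 𝓘(ℝ, EQ) (Pfaffian.homModel EM EP) Ψ q v ∈ Pfaffian.prolDist π H (Ψ q)) →
        Ψ = Φ)) ∧
    -- the factorisation when `Prol(P, H)` is a smooth submanifold, embedded by `ι`
    (∀ (EN : Type*) [NormedAddCommGroup EN] [NormedSpace ℝ EN] [FiniteDimensional ℝ EN]
      (N : Type*) [TopologicalSpace N] [ChartedSpace EN N] [IsManifold 𝓘(ℝ, EN) ∞ N]
      (ι : N → Pfaffian.HomBundle π)
      (hι : IsSmoothEmbedding 𝓘(ℝ, EN) (Pfaffian.homModel EM EP) ∞ ι)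
      (hN : range ι = Pfaffian.classicalProl π H),
      ∃ Φ : Q → N,
        ContMDiff 𝓘(ℝ, EQ) 𝓘(ℝ, EN) ∞ Φ ∧
        (∀ q, Pfaffian.pr π (ι (Φ q)) = φ q) ∧
        (∀ q, ∀ v ∈ K q,
          mfderiv 𝓘(ℝ, EQ) 𝓘(ℝ, EN) Φ q v ∈ Pfaffian.cartanPullback π ι (Φ q)) ∧
        (∀ q, ∀ u ∈ K q, ∀ v ∈ K q,
          Pfaffian.normalMap (fun n => Pfaffian.pr π (ι n)) (Pfaffian.cartanPullback π ι) H (Φ q)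
            (Pfaffian.mfderiv_pr_comp_mem (hι.contMDiff.mdifferentiable (by simp) (Φ q))
              (hN.le (mem_range_self (Φ q))).1)
            (Pfaffian.curvature 𝓘(ℝ, EN) (Pfaffian.cartanPullback π ι) (Φ q)
              (mfderiv 𝓘(ℝ, EQ) 𝓘(ℝ, EN) Φ q u)
              (mfderiv 𝓘(ℝ, EQ) 𝓘(ℝ, EN) Φ q v)) = 0) ∧
        (∀ Ψ : Q → N,
          ContMDiff 𝓘(ℝ, EQ) 𝓘(ℝ, EN) ∞ Ψ →
          (∀ q, Pfaffian.pr π (ι (Ψ q)) = φ q) →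
          (∀ q, ∀ v ∈ K q,
            mfderiv 𝓘(ℝ, EQ) 𝓘(ℝ, EN) Ψ q v ∈ Pfaffian.cartanPullback π ι (Ψ q)) →
          Ψ = Φ)) ∧
    -- surjectivity of `pr : Prol(P, H) → P`
    (∀ p : P, ∃ j ∈ Pfaffian.classicalProl π H, Pfaffian.pr π j = p) := by
  obtain rfl : πQ = fun q => π (φ q) := funext fun q => (hφ.over_base q).symm
  obtain ⟨Φ, hΦ, hΦC, hΦpr, hΦK⟩ := Pfaffian.exists_lift hQ hφ
  have hEP : CompleteSpace EP := FiniteDimensional.complete ℝ EP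
  have hEQ : CompleteSpace EQ := FiniteDimensional.complete ℝ EQ
  refine ⟨⟨Φ, hΦ, hΦC, hΦpr, fun q v hv => ⟨hΦK q v hv, ?_⟩, fun q u hu v hv => ⟨?_, ?_⟩, ?_⟩,
    ?_, ?_⟩
  · exact Pfaffian.mfderiv_mem_tangentTo hΦC (fun q => (hΦ q).1) q v
  · exact Pfaffian.normalMap_curvatureAlong_eq_zero Pfaffian.contMDiff_pr hP.smooth
      (fun j hj => Pfaffian.mfderiv_pr_mem hj) (hΦ q).1 inf_le_right _
      (hφ.curvature_comp_eq_zero (Pfaffian.contMDiff_pr.mdifferentiable (by simp))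
        (hΦC.mdifferentiable (by simp)) hΦpr hu hv)
  · exact Pfaffian.normalMap_curvatureAlong_eq_zero hφ.fibration.contMDiff hP.smooth
      (fun q _ => hφ.map_mem q) (mem_univ q) (by rw [Pfaffian.tangentTo_univ]; exact le_top) _
      (hφ.curvature_eq_zero q u hu v hv)
  · intro Ψ _ hΨC hΨpr hΨK
    exact Pfaffian.lift_unique hQ (hΨC.mdifferentiable (by simp)) (hΦC.mdifferentiable (by simp))
      hΨpr hΦpr (fun q v hv => (hΨK q v hv).1) hΦK
  · intro EN _ _ _ N _ _ _ ι hι hN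
    have hEN : CompleteSpace EN := FiniteDimensional.complete ℝ EN
    have hιd := hι.contMDiff.mdifferentiable (by simp)
    have hlift : ∀ q, ∃ n, ι n = Φ q := fun q => hN.ge (hΦ q)
    choose Φ' hΦ' using hlift
    obtain rfl : ι ∘ Φ' = Φ := funext hΦ'
    -- smoothness descends along the embedding `ι`
    have hcont : Continuous Φ' := hι.isEmbedding.continuous_iff.2 hΦC.continuous
    have hC : ContMDiff 𝓘(ℝ, EQ) 𝓘(ℝ, EN) ∞ Φ' := fun q =>
      (ContMDiffAt.iff_comp_isImmersionAt (hι.isImmersion.isImmersionAt (Φ' q))).2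
        ⟨hcont.continuousAt, hΦC q⟩
    have hd := hC.mdifferentiable (by simp)
    refine ⟨Φ', hC, hΦpr, fun q v hv =>
      (Pfaffian.mfderiv_mem_cartanPullback_iff (hιd _) (hd q) v).2 (hΦK q v hv),
      fun q u hu v hv => ?_, fun Ψ hΨC hΨpr hΨK => ?_⟩
    · have hprι : ContMDiff 𝓘(ℝ, EN) 𝓘(ℝ, EP) ∞ (fun n => Pfaffian.pr π (ι n)) :=
        Pfaffian.contMDiff_pr.comp hι.contMDiff
      exact Pfaffian.normalMap_curvatureAlong_eq_zero hprι hP.smooth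
        (fun n _ => Pfaffian.mfderiv_pr_comp_mem (hιd n) (hN.le (mem_range_self n)).1)
        (mem_univ _) (by rw [Pfaffian.tangentTo_univ]; exact le_top) _
        (hφ.curvature_comp_eq_zero (hprι.mdifferentiable (by simp)) hd hΦpr hu hv)
    · have hΨd := hΨC.mdifferentiable (by simp)
      have h := Pfaffian.lift_unique hQ (hιd.comp hΨd) (hΦC.mdifferentiable (by simp)) hΨpr hΦpr
        (fun q v hv => (Pfaffian.mfderiv_mem_cartanPullback_iff (hιd _) (hΨd q) v).1 (hΨK q v hv))
        hΦK
      exact funext fun q => hι.isEmbedding.injective (congrFun h q)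
  · intro p
    obtain ⟨q, rfl⟩ := hφ.fibration.surjective p
    exact ⟨Φ q, hΦ q, hΦpr q⟩
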